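/- Let $G$ be the hexagonal lattice in the plane with edges of length $1$, viewed as a metric graph with vertex set $\mathcal V$ and edge set $\mathcal E$. Its vertices split into two classes such that every edge joins the two classes; orient and parametrise every edge by $[0,1]$ from the first class to the second. Let $a>0$, $\kappa^{-1}\ge 0$, $m\ge 0$, and let $q\in L^2(0,1)$ be real-valued with $q(1-x)=q(x)$ for almost every $x$; the same potential $q$ is placed on every edge. For an edge $e$ with endpoint $\mathfrak v$ let $\partial u_e(\mathfrak v)$ be the derivative at $\mathfrak v$ in the direction towards $\mathfrak v$, i.e. $-u_e'(0)$ at the initial vertex and $u_e'(1)$ at the terminal vertex. Let $\mathcal A$ be the operator in the Hilbert space of square-summable families $\big((u_e)_{e\in\mathcal E},(u^\circ_{\mathfrak v})_{\mathfrak v\in\mathcal V}\big)$, $u_e\in L^2(0,1)$, $u^\circ_{\mathfrak v}\in\mathbb C$, with squared norm $\sum_e\|u_e\|_{L^2}^2+m\sum_{\mathfrak v}|u^\circ_{\mathfrak v}|^2$, acting by $$\big((u_e)_e,(u^\circ_{\mathfrak v})_{\mathfrak v}\big)\mapsto\Big((-a u_e''+q u_e)_e,\ \big(m^{-1}\textstyle\sum_{e\sim\mathfrak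 v}a\,\partial u_e(\mathfrak v)\big)_{\mathfrak v}\Big),$$ on the domain where all $u_e\in H^2(0,1)$, $\sum_e\|u_e\|_{H^2}^2<\infty$, and $u_e(\mathfrak v)+a\kappa^{-1}\partial u_e(\mathfrak v)=u^\circ_{\mathfrak v}$ for every vertex $\mathfrak v$ and every edge $e\sim\mathfrak v$. If $m=0$, the vertex components are dropped from the Hilbert space, $u^\circ_{\mathfrak v}$ denotes the common value of $u_e(\mathfrak v)+a\kappa^{-1}\partial u_e(\mathfrak v)$ over $e\sim\mathfrak v$ (required to exist), and the domain carries the additional condition $\sum_{e\sim\mathfrak v}a\,\partial u_e(\mathfrak v)=0$ at every $\mathfrak v$. (For $\kappa^{-1}=0$, i.e. rigid vertices, $u^\circ_{\mathfrak v}$ is the value of $u$ at $\mathfrak v$.) Let $\Sigma_0$ be the spectrum of the operator $-a\,\frac{d^2}{dx^2}+q$ in $L^2(0,1)$ whose domain consists of all $u\in H^2(0,1)$ with $$u(0)-a\kappa^{-1}u'(0)=0,\qquad u(1)+a\kappa^{-1}u'(1)=0.$$ Then every $\lambda\in\Sigma_0$ is an eigenvalue of $\mathcal A$ of infinite multiplicity,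 i.e. $\ker(\mathcal A-\lambda)$ is infinite-dimensional. Moreover $\ker(\mathcal A-\lambda)$ is generated by simple loop states: it is the closed linear span of those eigenfunctions of $\mathcal A$ for $\lambda$ which are supported on a single hexagon of $G$ (i.e. $u_e=0$ for every edge $e$ outside that hexagon) and vanish at the vertices, in the sense that $u^\circ_{\mathfrak v}=0$ for all $\mathfrak v\in\mathcal V$. -/

import Mathlib

open MeasureTheory Set
open scoped NNReal ENNReal

noncomputable section

namespace HexGraph

/-! ## One edge

Every edge has length one and is parametrised by `[0, 1]`. -/

/-- Lebesgue measure on the unit interval. -/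
abbrev unitMeasure : Measure ℝ := volume.restrict (Ioc (0 : ℝ) 1)

/-- The complex Hilbert space `L²(0, 1)`. -/
abbrev EdgeL2 : Type := Lp ℂ 2 unitMeasure

/-- `f` belongs to the Sobolev space `H²(0, 1)`: on `[0, 1]` the class `f` has the continuously
differentiable representative `u`, the derivative `du = u'` is absolutely continuous, and the
second (weak) derivative `d2 = u''` is in `L²(0, 1)`. In particular `u 0`, `u 1`, `du 0`, `du 1`
are the one-sided boundary values of `f` and `f'`. -/
structure IsH2 (f : EdgeL2) (u du : ℝ → ℂ) (d2 : EdgeL2) : Prop where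
  ae_eq : f =ᵐ[unitMeasure] u
  eq_integral : ∀ x ∈ Icc (0 : ℝ) 1, u x = u 0 + ∫ t in (0 : ℝ)..x, du t
  deriv_eq_integral : ∀ x ∈ Icc (0 : ℝ) 1, du x = du 0 + ∫ t in (0 : ℝ)..x, d2 t

theorem edgeL2_intervalIntegrable (g : EdgeL2) {x : ℝ} (hx : x ∈ Icc (0 : ℝ) 1) :
    IntervalIntegrable g volume 0 x := by
  rw [intervalIntegrable_iff_integrableOn_Ioc_of_le hx.1]
  have h : IntegrableOn g (Ioc (0 : ℝ) 1) volume :=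
    (Lp.memLp g).integrable (by norm_num)
  exact h.mono_set (Ioc_subset_Ioc_right hx.2)

theorem continuousOn_of_eq_integral {u g : ℝ → ℂ} (hg : IntegrableOn g (Ioc (0 : ℝ) 1) volume)
    (h : ∀ x ∈ Icc (0 : ℝ) 1, u x = u 0 + ∫ t in (0 : ℝ)..x, g t) :
    ContinuousOn u (Icc (0 : ℝ) 1) := by
  have hc : ContinuousOn (fun x => u 0 + ∫ t in (0 : ℝ)..x, g t) (Icc (0 : ℝ) 1) := by
    refine continuousOn_const.add ?_
    refine intervalIntegral.continuousOn_primitive_interval' (b₁ := 0) (b₂ := 1) ?_ ?_ |>.mono ?_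
    · rwa [intervalIntegrable_iff_integrableOn_Ioc_of_le zero_le_one]
    · simp
    · rw [uIcc_of_le zero_le_one]
  exact hc.congr h

namespace IsH2

variable {f f' : EdgeL2} {u du u' du' : ℝ → ℂ} {d2 d2' : EdgeL2}

theorem continuousOn_du (h : IsH2 f u du d2) : ContinuousOn du (Icc (0 : ℝ) 1) :=
  continuousOn_of_eq_integral ((Lp.memLp d2).integrable (by norm_num)) h.deriv_eq_integral

theorem intervalIntegrable_du (h : IsH2 f u du d2) {x : ℝ} (hx : x ∈ Icc (0 : ℝ) 1) :
    IntervalIntegrable du volume 0 x := by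
  refine ContinuousOn.intervalIntegrable (h.continuousOn_du.mono ?_)
  rw [uIcc_of_le hx.1]
  exact Icc_subset_Icc_right hx.2

theorem continuousOn_u (h : IsH2 f u du d2) : ContinuousOn u (Icc (0 : ℝ) 1) := by
  refine continuousOn_of_eq_integral ?_ h.eq_integral
  rw [← intervalIntegrable_iff_integrableOn_Ioc_of_le zero_le_one]
  exact h.intervalIntegrable_du (by simp)

theorem add (h : IsH2 f u du d2) (h' : IsH2 f' u' du' d2') :
    IsH2 (f + f') (u + u') (du + du') (d2 + d2') where
  ae_eq := by
    filter_upwards [Lp.coeFn_add f f', h.ae_eq, h'.ae_eq] with x h1 h2 h3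
    rw [h1, Pi.add_apply, h2, h3, Pi.add_apply]
  eq_integral x hx := by
    have : ∫ t in (0 : ℝ)..x, (du + du') t
        = (∫ t in (0 : ℝ)..x, du t) + ∫ t in (0 : ℝ)..x, du' t :=
      intervalIntegral.integral_add (h.intervalIntegrable_du hx) (h'.intervalIntegrable_du hx)
    rw [this, Pi.add_apply, Pi.add_apply, h.eq_integral x hx, h'.eq_integral x hx]
    ring
  deriv_eq_integral x hx := by
    have : ∫ t in (0 : ℝ)..x, (d2 + d2' : EdgeL2) t
        = ∫ t in (0 : ℝ)..x, (d2 t + d2' t) := by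
      refine intervalIntegral.integral_congr_ae_restrict ?_
      rw [uIoc_of_le hx.1]
      exact ae_restrict_of_ae_restrict_of_subset (Ioc_subset_Ioc_right hx.2)
        (Lp.coeFn_add d2 d2')
    rw [this, intervalIntegral.integral_add (edgeL2_intervalIntegrable _ hx)
      (edgeL2_intervalIntegrable _ hx), Pi.add_apply, Pi.add_apply, h.deriv_eq_integral x hx,
      h'.deriv_eq_integral x hx]
    ring

theorem smul (c : ℂ) (h : IsH2 f u du d2) : IsH2 (c • f) (c • u) (c • du) (c • d2) where
  ae_eq := by
    filter_upwards [Lp.coeFn_smul c f, h.ae_eq] with x h1 h2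
    rw [h1, Pi.smul_apply, h2, Pi.smul_apply]
  eq_integral x hx := by
    have : ∫ t in (0 : ℝ)..x, (c • du) t = c * ∫ t in (0 : ℝ)..x, du t := by
      simp
    rw [this, Pi.smul_apply, Pi.smul_apply, h.eq_integral x hx]
    simp [mul_add]
  deriv_eq_integral x hx := by
    have : ∫ t in (0 : ℝ)..x, (c • d2 : EdgeL2) t = ∫ t in (0 : ℝ)..x, c * d2 t := by
      refine intervalIntegral.integral_congr_ae_restrict ?_
      rw [uIoc_of_le hx.1]
      exact ae_restrict_of_ae_restrict_of_subset (Ioc_subset_Ioc_right hx.2)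
        (Lp.coeFn_smul c d2)
    rw [this, Pi.smul_apply, Pi.smul_apply, h.deriv_eq_integral x hx]
    simp [mul_add]

theorem zero : IsH2 0 0 0 0 where
  ae_eq := Lp.coeFn_zero _ _ _
  eq_integral x _ := by simp
  deriv_eq_integral x hx := by
    have : ∫ t in (0 : ℝ)..x, (0 : EdgeL2) t = ∫ _ in (0 : ℝ)..x, (0 : ℂ) := by
      refine intervalIntegral.integral_congr_ae_restrict ?_
      rw [uIoc_of_le hx.1]
      exact ae_restrict_of_ae_restrict_of_subset (Ioc_subset_Ioc_right hx.2)
        (Lp.coeFn_zero ℂ 2 unitMeasure)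
    rw [this]
    simp

theorem eq_zero_of_primitive_eq_zero {g : ℝ → ℂ} (hg : IntervalIntegrable g volume 0 1)
    (h : ∀ x ∈ Icc (0 : ℝ) 1, ∫ t in (0 : ℝ)..x, g t = 0) : g =ᵐ[unitMeasure] 0 := by
  have h1 := hg.ae_hasDerivAt_integral
  have h2 : ∀ᵐ x : ℝ, x ≠ 1 := by
    simp [ae_iff]
  refine (ae_restrict_iff' measurableSet_Ioc).2 ?_
  filter_upwards [h1, h2] with x hx hx1 hxm
  have hx2 : x < 1 := lt_of_le_of_ne hxm.2 hx1
  have hd := hx (by rw [uIcc_of_le zero_le_one]; exact ⟨hxm.1.le, hxm.2⟩) 0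
    (by rw [uIcc_of_le zero_le_one]; simp)
  have hz : HasDerivAt (fun y => ∫ t in (0 : ℝ)..y, g t) 0 x := by
    refine (hasDerivAt_const x (0 : ℂ)).congr_of_eventuallyEq ?_
    filter_upwards [Ioo_mem_nhds hxm.1 hx2] with y hy
    exact h y ⟨hy.1.le, hy.2.le⟩
  exact hd.unique hz

theorem eq_zero_of_ae_eq_zero {u : ℝ → ℂ} (hu : ContinuousOn u (Icc (0 : ℝ) 1))
    (h : u =ᵐ[unitMeasure] 0) : ∀ x ∈ Icc (0 : ℝ) 1, u x = 0 := by
  have h' : u =ᵐ[volume.restrict (Icc (0 : ℝ) 1)] fun _ => (0 : ℂ) := by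
    rw [← Measure.restrict_congr_set Ioc_ae_eq_Icc]
    exact h
  intro x hx
  exact Measure.eqOn_Icc_of_ae_eq volume zero_ne_one h' hu continuousOn_const hx

/-- The derivatives of the zero function vanish: `u`, `du` and `d2` are determined by `f`. -/
theorem of_eq_zero (h : IsH2 0 u du d2) :
    (∀ x ∈ Icc (0 : ℝ) 1, u x = 0) ∧ (∀ x ∈ Icc (0 : ℝ) 1, du x = 0) ∧ d2 = 0 := by
  have hu : ∀ x ∈ Icc (0 : ℝ) 1, u x = 0 :=
    eq_zero_of_ae_eq_zero h.continuousOn_u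
      (h.ae_eq.symm.trans (Lp.coeFn_zero ℂ 2 unitMeasure))
  have hdu : ∀ x ∈ Icc (0 : ℝ) 1, du x = 0 := by
    refine eq_zero_of_ae_eq_zero h.continuousOn_du
      (eq_zero_of_primitive_eq_zero (h.intervalIntegrable_du (by simp)) fun x hx => ?_)
    have := h.eq_integral x hx
    rw [hu x hx, hu 0 (by simp)] at this
    simpa using this.symm
  refine ⟨hu, hdu, ?_⟩
  rw [Lp.eq_zero_iff_ae_eq_zero]
  refine eq_zero_of_primitive_eq_zero (edgeL2_intervalIntegrable _ (by simp)) fun x hx => ?_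
  have := h.deriv_eq_integral x hx
  rw [hdu x hx, hdu 0 (by simp)] at this
  simpa using this.symm

end IsH2

/-! ## Unbounded operators -/

section Operators

variable {H : Type*} [NormedAddCommGroup H] [NormedSpace ℂ H]

/-- The resolvent set of an unbounded operator `T`: those `z` for which `T - z` is a bijection of
the domain of `T` onto `H` with a bounded inverse `R`. -/
def resolventSet (T : H →ₗ.[ℂ] H) : Set ℂ :=
  {z | ∃ R : H →L[ℂ] H, (∀ x : T.domain, R (T x - z • (x : H)) = x) ∧
    ∀ y : H, ∃ x : T.domain, (x : H) = R y ∧ T x - z • (x : H) = y}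

/-- The spectrum of an unbounded operator. -/
def unboundedSpectrum (T : H →ₗ.[ℂ] H) : Set ℂ := (resolventSet T)ᶜ

/-- The eigenspace of an unbounded operator: all `x` in the domain of `T` with `T x = z x`. -/
def eigenspace (T : H →ₗ.[ℂ] H) (z : ℂ) : Submodule ℂ H where
  carrier := {x | ∃ hx : x ∈ T.domain, T ⟨x, hx⟩ = z • x}
  add_mem' := by
    rintro x y ⟨hx, hx'⟩ ⟨hy, hy'⟩
    refine ⟨T.domain.add_mem hx hy, ?_⟩
    rw [smul_add, ← hx', ← hy', ← LinearPMap.map_add]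
    rfl
  zero_mem' := ⟨T.domain.zero_mem, by rw [smul_zero]; exact T.map_zero⟩
  smul_mem' := by
    rintro c x ⟨hx, hx'⟩
    refine ⟨T.domain.smul_mem c hx, ?_⟩
    rw [smul_comm, ← hx', ← LinearPMap.map_smul]
    rfl

end Operators

/-! ## The Robin problem on one edge -/

/-- `f ∈ H²(0, 1)` satisfies the Robin conditions `f(0) - a κ⁻¹ f'(0) = 0` and
`f(1) + a κ⁻¹ f'(1) = 0`, and `g = -a f'' + q f`. The number `κinv` stands for `κ⁻¹`. -/
def IsRobinPair (a : ℝ) (κinv : ℝ≥0) (q : ℝ → ℝ) (f g : EdgeL2) : Prop :=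
  ∃ (u du : ℝ → ℂ) (d2 : EdgeL2), IsH2 f u du d2 ∧
    (g =ᵐ[unitMeasure] fun x => -(a : ℂ) * d2 x + (q x : ℂ) * u x) ∧
    u 0 - (a : ℂ) * (κinv : ℂ) * du 0 = 0 ∧ u 1 + (a : ℂ) * (κinv : ℂ) * du 1 = 0

/-- The graph of the edge operator. -/
def edgeGraph (a : ℝ) (κinv : ℝ≥0) (q : ℝ → ℝ) : Submodule ℂ (EdgeL2 × EdgeL2) where
  carrier := {p | IsRobinPair a κinv q p.1 p.2}
  add_mem' := by
    rintro ⟨f, g⟩ ⟨f', g'⟩ ⟨u, du, d2, h, hg, h0, h1⟩ ⟨u', du', d2', h', hg', h0', h1'⟩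
    refine ⟨u + u', du + du', d2 + d2', h.add h', ?_, ?_, ?_⟩
    · filter_upwards [Lp.coeFn_add g g', Lp.coeFn_add d2 d2', hg, hg'] with x e1 e2 e3 e4
      change (g + g' : EdgeL2) x = _
      rw [e1, e2, Pi.add_apply, Pi.add_apply, Pi.add_apply, e3, e4]
      ring
    · simp only [Pi.add_apply]
      linear_combination h0 + h0'
    · simp only [Pi.add_apply]
      linear_combination h1 + h1'
  zero_mem' := by
    refine ⟨0, 0, 0, IsH2.zero, ?_, by simp, by simp⟩
    filter_upwards [Lp.coeFn_zero ℂ 2 unitMeasure] with x e1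
    change (0 : EdgeL2) x = _
    rw [e1]
    simp
  smul_mem' := by
    rintro c ⟨f, g⟩ ⟨u, du, d2, h, hg, h0, h1⟩
    refine ⟨c • u, c • du, c • d2, h.smul c, ?_, ?_, ?_⟩
    · filter_upwards [Lp.coeFn_smul c g, Lp.coeFn_smul c d2, hg] with x e1 e2 e3
      change (c • g : EdgeL2) x = _
      rw [e1, e2, Pi.smul_apply, Pi.smul_apply, Pi.smul_apply, e3]
      simp only [smul_eq_mul]
      ring
    · simp only [Pi.smul_apply, smul_eq_mul]
      linear_combination c * h0
    · simp only [Pi.smul_apply, smul_eq_mul]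
      linear_combination c * h1

theorem edgeGraph_functional (a : ℝ) (κinv : ℝ≥0) (q : ℝ → ℝ) (p : EdgeL2 × EdgeL2)
    (hp : p ∈ edgeGraph a κinv q) (h0 : p.1 = 0) : p.2 = 0 := by
  obtain ⟨f, g⟩ := p
  obtain rfl : f = 0 := h0
  obtain ⟨u, du, d2, h, hg, -, -⟩ := hp
  obtain ⟨hu, -, rfl⟩ := h.of_eq_zero
  change g = 0
  rw [Lp.eq_zero_iff_ae_eq_zero]
  filter_upwards [hg, Lp.coeFn_zero ℂ 2 unitMeasure, ae_restrict_mem measurableSet_Ioc]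
    with x e1 e2 e3
  have e1' : g x = -(a : ℂ) * (0 : EdgeL2) x + (q x : ℂ) * u x := e1
  rw [e1', e2, hu x ⟨e3.1.le, e3.2⟩]
  simp

/-- The operator `-a d²/dx² + q` in `L²(0, 1)` with domain all `f ∈ H²(0, 1)` such that
`f(0) - a κ⁻¹ f'(0) = 0` and `f(1) + a κ⁻¹ f'(1) = 0`. -/
def edgeOperator (a : ℝ) (κinv : ℝ≥0) (q : ℝ → ℝ) : EdgeL2 →ₗ.[ℂ] EdgeL2 :=
  (edgeGraph a κinv q).toLinearPMap

/-- The operator has the graph it was defined by. -/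
theorem graph_edgeOperator (a : ℝ) (κinv : ℝ≥0) (q : ℝ → ℝ) :
    (edgeOperator a κinv q).graph = edgeGraph a κinv q :=
  Submodule.toLinearPMap_graph_eq _ (edgeGraph_functional a κinv q)

/-- The spectrum `Σ₀` of the edge operator. -/
def Sigma0 (a : ℝ) (κinv : ℝ≥0) (q : ℝ → ℝ) : Set ℂ :=
  unboundedSpectrum (edgeOperator a κinv q)

/-! ## The hexagonal lattice

Let `d₀, d₁, d₂` be the three unit vectors of the plane at mutual angles of 120 degrees,
`b₁ = d₀ - d₁` and `b₂ = d₀ - d₂`. The cell `n = (n₁, n₂)` contains the vertices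
`inl n` at `n₁ b₁ + n₂ b₂` and `inr n` at `n₁ b₁ + n₂ b₂ + d₀`. The edge `(n, i)` is the unit
segment from `inl n` in the direction `dᵢ`. -/

/-- The vertices. -/
abbrev Vertex : Type := (ℤ × ℤ) ⊕ (ℤ × ℤ)

/-- The edges. -/
abbrev Edge : Type := (ℤ × ℤ) × Fin 3

/-- `d₀ - dᵢ` in the basis `b₁, b₂`. -/
def shift : Fin 3 → ℤ × ℤ := ![(0, 0), (1, 0), (0, 1)]

/-- The vertex at the parameter value `0` of an edge. -/
def origin (e : Edge) : Vertex := Sum.inl e.1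

/-- The vertex at the parameter value `1` of an edge. -/
def terminus (e : Edge) : Vertex := Sum.inr (e.1 - shift e.2)

/-- The six edges of a hexagon, listed in cyclic order. Every hexagon of the lattice is obtained
for exactly one `n`. -/
def hexagon (n : ℤ × ℤ) : Finset Edge :=
  {(n, 0), (n + (1, 0), 1), (n + (1, 0), 2), (n + (1, -1), 0), (n + (1, -1), 1), (n, 2)}

/-! ## The Hamiltonian -/

/-- `L²` of the union of all edges. -/
abbrev EdgesL2 : Type := lp (fun _ : Edge => EdgeL2) 2

/-- `ℓ²` of the vertices, each of which carries the mass `m` (so this is trivial for `m = 0`). -/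
abbrev VertexL2 (m : ℝ≥0) : Type :=
  Lp ℂ 2 ((m : ℝ≥0∞) • (Measure.count : Measure Vertex))

/-- The Hilbert space `L²(G)` of pairs (functions on the edges, displacements of the vertices). -/
abbrev GraphL2 (m : ℝ≥0) : Type := WithLp 2 (EdgesL2 × VertexL2 m)

/-- The net force at a vertex: the sum over the adjacent edges of `a` times the derivative towards
the vertex. The edges adjacent to `inl n` are the `(n, i)`, which start there, and the edges
adjacent to `inr n` are the `(n + shift i, i)`, which end there. -/
def netForce (a : ℝ) (du : Edge → ℝ → ℂ) : Vertex → ℂ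
  | Sum.inl n => ∑ i : Fin 3, -((a : ℂ) * du (n, i) 0)
  | Sum.inr n => ∑ i : Fin 3, (a : ℂ) * du (n + shift i, i) 1

/-- `U` is in the domain of the Hamiltonian and `F` is its image:
* on every edge `U` is in `H²` (and the second derivatives form an element `d2` of `L²`), and
  `F = -a U'' + q U`;
* at every vertex the limits along all adjacent edges satisfy `u + a κ⁻¹ ∂u = ω`, where `∂` is the
  derivative towards the vertex and `ω` is the displacement of the vertex;
* at every vertex the net force is `m` times the vertex component `φ` of `F`.

For `m > 0` the functions `ω` and `φ` are the vertex components of `U` and `F`; for `m = 0` there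
are no such components, `ω` is the common value in the second condition, and the third one says
that the net force vanishes. -/
structure IsHamiltonianPair (a : ℝ) (κinv m : ℝ≥0) (q : ℝ → ℝ) (U F : GraphL2 m)
    (u du : Edge → ℝ → ℂ) (d2 : EdgesL2) (ω φ : Vertex → ℂ) : Prop where
  isH2 : ∀ e, IsH2 (U.fst e) (u e) (du e) (d2 e)
  edge_eq : ∀ e, F.fst e =ᵐ[unitMeasure] fun x => -(a : ℂ) * d2 e x + (q x : ℂ) * u e x
  displacement : U.snd =ᵐ[(m : ℝ≥0∞) • (Measure.count : Measure Vertex)] ω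
  acceleration : F.snd =ᵐ[(m : ℝ≥0∞) • (Measure.count : Measure Vertex)] φ
  robin_origin : ∀ e, u e 0 - (a : ℂ) * (κinv : ℂ) * du e 0 = ω (origin e)
  robin_terminus : ∀ e, u e 1 + (a : ℂ) * (κinv : ℂ) * du e 1 = ω (terminus e)
  force : ∀ v, netForce a du v = (m : ℂ) * φ v

/-- The graph of the Hamiltonian. -/
def hamiltonianGraph (a : ℝ) (κinv m : ℝ≥0) (q : ℝ → ℝ) :
    Submodule ℂ (GraphL2 m × GraphL2 m) where
  carrier := {p | ∃ u du d2 ω φ, IsHamiltonianPair a κinv m q p.1 p.2 u du d2 ω φ}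
  add_mem' := by
    rintro ⟨U, F⟩ ⟨U', F'⟩ ⟨u, du, d2, ω, φ, h⟩ ⟨u', du', d2', ω', φ', h'⟩
    refine ⟨u + u', du + du', d2 + d2', ω + ω', φ + φ',
      fun e => (h.isH2 e).add (h'.isH2 e), fun e => ?_, ?_, ?_, fun e => ?_, fun e => ?_,
      fun v => ?_⟩
    · filter_upwards [Lp.coeFn_add (F.fst e) (F'.fst e), Lp.coeFn_add (d2 e) (d2' e),
        h.edge_eq e, h'.edge_eq e] with x e1 e2 e3 e4
      change (F.fst e + F'.fst e : EdgeL2) x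
        = -(a : ℂ) * (d2 e + d2' e : EdgeL2) x + (q x : ℂ) * (u e x + u' e x)
      rw [e1, e2, Pi.add_apply, Pi.add_apply, e3, e4]
      ring
    · exact (Lp.coeFn_add U.snd U'.snd).trans (h.displacement.add h'.displacement)
    · exact (Lp.coeFn_add F.snd F'.snd).trans (h.acceleration.add h'.acceleration)
    · simp only [Pi.add_apply]
      linear_combination h.robin_origin e + h'.robin_origin e
    · simp only [Pi.add_apply]
      linear_combination h.robin_terminus e + h'.robin_terminus e
    · have e1 := h.force v
      have e2 := h'.force v
      have e3 : netForce a (du + du') v = netForce a du v + netForce a du' v := by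
        rcases v with n | n <;> simp only [netForce, ← Finset.sum_add_distrib] <;>
          exact Finset.sum_congr rfl fun i _ => by simp only [Pi.add_apply]; ring
      rw [e3, e1, e2, Pi.add_apply]
      ring
  zero_mem' := by
    refine ⟨0, 0, 0, 0, 0, fun e => IsH2.zero, fun e => ?_, Lp.coeFn_zero _ _ _,
      Lp.coeFn_zero _ _ _, fun e => by simp, fun e => by simp, fun v => ?_⟩
    · filter_upwards [Lp.coeFn_zero ℂ 2 unitMeasure] with x e1
      change (0 : EdgeL2) x = -(a : ℂ) * (0 : EdgeL2) x + (q x : ℂ) * 0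
      rw [e1]
      simp
    · rcases v with n | n <;> simp [netForce]
  smul_mem' := by
    rintro c ⟨U, F⟩ ⟨u, du, d2, ω, φ, h⟩
    refine ⟨c • u, c • du, c • d2, c • ω, c • φ,
      fun e => (h.isH2 e).smul c, fun e => ?_, ?_, ?_, fun e => ?_, fun e => ?_, fun v => ?_⟩
    · filter_upwards [Lp.coeFn_smul c (F.fst e), Lp.coeFn_smul c (d2 e), h.edge_eq e]
        with x e1 e2 e3
      change (c • F.fst e : EdgeL2) x
        = -(a : ℂ) * (c • d2 e : EdgeL2) x + (q x : ℂ) * (c * u e x)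
      rw [e1, e2, Pi.smul_apply, Pi.smul_apply, e3]
      simp only [smul_eq_mul]
      ring
    · exact (Lp.coeFn_smul c U.snd).trans (h.displacement.const_smul c)
    · exact (Lp.coeFn_smul c F.snd).trans (h.acceleration.const_smul c)
    · simp only [Pi.smul_apply, smul_eq_mul]
      linear_combination c * h.robin_origin e
    · simp only [Pi.smul_apply, smul_eq_mul]
      linear_combination c * h.robin_terminus e
    · have e1 := h.force v
      have e3 : netForce a (c • du) v = c * netForce a du v := by
        rcases v with n | n <;> simp only [netForce, Finset.mul_sum] <;>
          exact Finset.sum_congr rfl fun i _ => by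
            simp only [Pi.smul_apply, smul_eq_mul]; ring
      rw [e3, e1, Pi.smul_apply, smul_eq_mul]
      ring

theorem hamiltonianGraph_functional (a : ℝ) (κinv m : ℝ≥0) (q : ℝ → ℝ)
    (p : GraphL2 m × GraphL2 m) (hp : p ∈ hamiltonianGraph a κinv m q) (h0 : p.1 = 0) :
    p.2 = 0 := by
  obtain ⟨U, F⟩ := p
  obtain rfl : U = 0 := h0
  obtain ⟨u, du, d2, ω, φ, h⟩ := hp
  have hz : ∀ e, IsH2 0 (u e) (du e) (d2 e) := h.isH2
  have h1 : F.fst = 0 := by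
    ext1
    funext e
    change F.fst e = 0
    obtain ⟨hu, -, hd⟩ := (hz e).of_eq_zero
    rw [Lp.eq_zero_iff_ae_eq_zero]
    have he := h.edge_eq e
    rw [hd] at he
    filter_upwards [he, Lp.coeFn_zero ℂ 2 unitMeasure, ae_restrict_mem measurableSet_Ioc]
      with x e1 e2 e3
    have e1' : F.fst e x = -(a : ℂ) * (0 : EdgeL2) x + (q x : ℂ) * u e x := e1
    rw [e1', e2, hu x ⟨e3.1.le, e3.2⟩]
    simp
  have h2 : F.snd = 0 := by
    rw [Lp.eq_zero_iff_ae_eq_zero]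
    by_cases hm : m = 0
    · subst hm
      simp [Filter.EventuallyEq]
    · have hφ : φ = 0 := by
        funext v
        have hv := h.force v
        have h0 : netForce a du v = 0 := by
          rcases v with n | n
          · refine Finset.sum_eq_zero fun i _ => ?_
            rw [(hz (n, i)).of_eq_zero.2.1 0 (by simp)]
            simp
          · refine Finset.sum_eq_zero fun i _ => ?_
            rw [(hz (n + shift i, i)).of_eq_zero.2.1 1 (by simp)]
            simp
        rw [h0] at hv
        have hm' : (m : ℂ) ≠ 0 := by exact_mod_cast hm
        exact (mul_eq_zero.1 hv.symm).resolve_left hm'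
      have := h.acceleration
      rwa [hφ] at this
  change F = 0
  exact (WithLp.ofLp_injective 2) (Prod.ext h1 h2)

/-- The Hamiltonian `𝒜` of the hexagonal lattice. -/
def hamiltonian (a : ℝ) (κinv m : ℝ≥0) (q : ℝ → ℝ) : GraphL2 m →ₗ.[ℂ] GraphL2 m :=
  (hamiltonianGraph a κinv m q).toLinearPMap

/-- The operator has the graph it was defined by. -/
theorem graph_hamiltonian (a : ℝ) (κinv m : ℝ≥0) (q : ℝ → ℝ) :
    (hamiltonian a κinv m q).graph = hamiltonianGraph a κinv m q :=
  Submodule.toLinearPMap_graph_eq _ (hamiltonianGraph_functional a κinv m q)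

/-- A simple loop state: an eigenfunction of the Hamiltonian which vanishes on all edges outside
one hexagon and whose displacement `ω` vanishes at all vertices. -/
def IsSimpleLoopState (a : ℝ) (κinv m : ℝ≥0) (q : ℝ → ℝ) (z : ℂ) (U : GraphL2 m) : Prop :=
  U ≠ 0 ∧ U ∈ eigenspace (hamiltonian a κinv m q) z ∧
    (∃ n, ∀ e ∉ hexagon n, U.fst e = 0) ∧
    ∃ u du d2 φ, IsHamiltonianPair a κinv m q U (z • U) u du d2 0 φ

end HexGraph

end

/-!
Let `z` be in the spectrum of the edge operator and write `s = a κ⁻¹`, `P = (q - z) / a`, so that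
the eigenvalue equation on an edge is `u'' = P u`.

*One edge.* On continuous functions the initial value problem is `(1 - V) u = ...`, where `V` is
the Volterra operator `u ↦ ∫∫ P u`; conjugation by `exp (k x)` makes `V` a contraction, so `1 - V`
is invertible (`isUnit_one_sub_volterra`). If the solution with `u(0) = s`, `u'(0) = 1` violated the
Robin condition at `1`, then superposition would solve the inhomogeneous Robin problem boundedly and
`z` would be in the resolvent set. Hence it is an eigenfunction `f` (`exists_isRobinSolution`).

*The eigenspace.* The Wronskian of `f` and an eigenfunction of the Hamiltonian is constant on each
edge, which says that the displacements at the two ends of an edge have the ratio `f'(1) : f'(0)`.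
So the displacement is constant along rows of the lattice. By square-summability it tends to zero at
infinity, so it vanishes (`displacement_eq_zero`). The eigenfunction is therefore a multiple of `f`
on every edge, and the force balance is Kirchhoff's rule for the coefficients
(`mem_eigenspace_iff`).

*Loop states.* Alternating coefficients around a hexagon obey Kirchhoff's rule; this gives infinitely
many linearly independent simple loop states. An element of the eigenspace orthogonal to all of them
has coefficients with neither sources nor circulation. Such a discrete field is harmonic on a
triangular lattice, and it tends to zero at infinity, so it vanishes by the maximum principle
(`IsFlow.eq_zero`). Since the eigenspace is closed, the loop states span a dense subspace of it.
-/

namespace HexGraph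

noncomputable section

/-! ### The initial value problem with a square-integrable coefficient -/


instance : IsProbabilityMeasure unitMeasure := ⟨by simp⟩

theorem integral_norm_le_norm (g : EdgeL2) : ∫ t, ‖g t‖ ∂unitMeasure ≤ ‖g‖ := by
  have hg : MemLp g 2 unitMeasure := Lp.memLp g
  rw [integral_norm_eq_lintegral_enorm hg.1, ← eLpNorm_one_eq_lintegral_enorm, Lp.norm_def]
  exact ENNReal.toReal_mono (Lp.eLpNorm_ne_top g)
    (eLpNorm_le_eLpNorm_of_exponent_le (by norm_num) hg.1)

theorem norm_intervalIntegral_le_norm (g : EdgeL2) {x : ℝ} (hx : x ∈ Icc (0 : ℝ) 1) :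
    ‖∫ t in (0 : ℝ)..x, g t‖ ≤ ‖g‖ := by
  refine (intervalIntegral.norm_integral_le_integral_norm hx.1).trans ?_
  refine le_trans ?_ (integral_norm_le_norm g)
  rw [intervalIntegral.integral_of_le hx.1]
  exact setIntegral_mono_set ((Lp.memLp g).integrable (by norm_num)).norm
    (Filter.Eventually.of_forall fun _ => norm_nonneg _)
    (Ioc_subset_Ioc_right hx.2).eventuallyLE

theorem intervalIntegral_congr_unit {f g : ℝ → ℂ} (h : f =ᵐ[unitMeasure] g) {x : ℝ}
    (hx : x ∈ Icc (0 : ℝ) 1) : ∫ t in (0 : ℝ)..x, f t = ∫ t in (0 : ℝ)..x, g t := by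
  refine intervalIntegral.integral_congr_ae_restrict ?_
  rw [uIoc_of_le hx.1]
  exact ae_restrict_of_ae_restrict_of_subset (Ioc_subset_Ioc_right hx.2) h

theorem continuous_intervalIntegral (g : EdgeL2) :
    Continuous fun x : unitInterval => ∫ t in (0 : ℝ)..x, g t := by
  have h : ContinuousOn (fun x : ℝ => ∫ t in (0 : ℝ)..x, g t) (Icc (0 : ℝ) 1) :=
    continuousOn_of_eq_integral ((Lp.memLp g).integrable (by norm_num)) (fun x _ => by simp)
  exact continuousOn_iff_continuous_domRestrict.1 h

/-- The primitive of a square-integrable function that vanishes at `0`. -/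
def primitive : EdgeL2 →L[ℂ] C(unitInterval, ℂ) :=
  LinearMap.mkContinuous
    { toFun g := ⟨fun x => ∫ t in (0 : ℝ)..x, g t, continuous_intervalIntegral g⟩
      map_add' f g := by
        ext x
        change ∫ t in (0 : ℝ)..x, (f + g : EdgeL2) t
          = (∫ t in (0 : ℝ)..x, f t) + ∫ t in (0 : ℝ)..x, g t
        rw [← intervalIntegral.integral_add (edgeL2_intervalIntegrable _ x.2)
          (edgeL2_intervalIntegrable _ x.2)]
        exact intervalIntegral_congr_unit (Lp.coeFn_add f g) x.2
      map_smul' c g := by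
        ext x
        change ∫ t in (0 : ℝ)..x, (c • g : EdgeL2) t = c • ∫ t in (0 : ℝ)..x, g t
        rw [← intervalIntegral.integral_smul]
        exact intervalIntegral_congr_unit (Lp.coeFn_smul c g) x.2 }
    1 fun g => by
      rw [one_mul, ContinuousMap.norm_le _ (norm_nonneg g)]
      exact fun x => norm_intervalIntegral_le_norm g x.2

theorem primitive_apply (g : EdgeL2) (x : unitInterval) :
    primitive g x = ∫ t in (0 : ℝ)..x, g t := rfl

/-- The extension of a function on the unit interval to the line, constant outside the interval. -/
abbrev ext (u : C(unitInterval, ℂ)) : ℝ → ℂ := IccExtend zero_le_one u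

theorem ext_of_mem (u : C(unitInterval, ℂ)) {x : ℝ} (hx : x ∈ Icc (0 : ℝ) 1) :
    ext u x = u ⟨x, hx⟩ := IccExtend_of_mem _ _ hx

theorem continuous_ext (u : C(unitInterval, ℂ)) : Continuous (ext u) := u.continuous.Icc_extend'

theorem norm_ext_le (u : C(unitInterval, ℂ)) (x : ℝ) : ‖ext u x‖ ≤ ‖u‖ := u.norm_coe_le_norm _

theorem memLp_mul_ext {P : ℝ → ℂ} (hP : MemLp P 2 unitMeasure) (u : C(unitInterval, ℂ)) :
    MemLp (fun x => P x * ext u x) 2 unitMeasure := by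
  refine hP.of_le_mul (c := ‖u‖) (hP.1.mul (continuous_ext u).aestronglyMeasurable)
    (Filter.Eventually.of_forall fun x => ?_)
  rw [norm_mul, mul_comm]
  gcongr
  exact norm_ext_le u x

theorem norm_toLp_mul_ext_le {P : ℝ → ℂ} (hP : MemLp P 2 unitMeasure)
    (u : C(unitInterval, ℂ)) : ‖(memLp_mul_ext hP u).toLp‖ ≤ ‖hP.toLp‖ * ‖u‖ := by
  rw [mul_comm]
  refine Lp.norm_le_mul_norm_of_ae_le_mul ?_
  filter_upwards [(memLp_mul_ext hP u).coeFn_toLp, hP.coeFn_toLp] with x h1 h2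
  rw [h1, h2, norm_mul, mul_comm]
  gcongr
  exact norm_ext_le u x

/-- Multiplication by a square-integrable function, from continuous to square-integrable
functions. -/
def mulL2 (P : ℝ → ℂ) (hP : MemLp P 2 unitMeasure) : C(unitInterval, ℂ) →L[ℂ] EdgeL2 :=
  LinearMap.mkContinuous
    { toFun u := (memLp_mul_ext hP u).toLp
      map_add' u v := by
        rw [← MemLp.toLp_add]
        congr 1
        funext x
        simp [IccExtend, mul_add]
      map_smul' c u := by
        rw [RingHom.id_apply, ← MemLp.toLp_const_smul]
        congr 1
        funext x
        simp [IccExtend]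
        ring }
    ‖hP.toLp‖ (norm_toLp_mul_ext_le hP)

theorem coeFn_mulL2 {P : ℝ → ℂ} (hP : MemLp P 2 unitMeasure) (u : C(unitInterval, ℂ)) :
    mulL2 P hP u =ᵐ[unitMeasure] fun x => P x * ext u x :=
  (memLp_mul_ext hP u).coeFn_toLp

/-- The inclusion of the continuous functions into `L²`. -/
def incl : C(unitInterval, ℂ) →L[ℂ] EdgeL2 := mulL2 (fun _ => 1) (memLp_const 1)

theorem coeFn_incl (u : C(unitInterval, ℂ)) : incl u =ᵐ[unitMeasure] ext u := by
  filter_upwards [coeFn_mulL2 (memLp_const 1) u] with x hx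
  rw [incl, hx, one_mul]

/-- The Volterra operator `u ↦ ∫₀ˣ ∫₀ˢ P u` of the equation `u'' = P u`. -/
def volterra (P : ℝ → ℂ) (hP : MemLp P 2 unitMeasure) :
    C(unitInterval, ℂ) →L[ℂ] C(unitInterval, ℂ) :=
  primitive ∘L incl ∘L primitive ∘L mulL2 P hP

theorem volterra_apply {P : ℝ → ℂ} (hP : MemLp P 2 unitMeasure) (u : C(unitInterval, ℂ))
    (x : unitInterval) :
    volterra P hP u x = ∫ s in (0 : ℝ)..x, ext (primitive (mulL2 P hP u)) s := by
  change primitive (incl (primitive (mulL2 P hP u))) x = _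
  rw [primitive_apply]
  exact intervalIntegral_congr_unit (coeFn_incl _) x.2

/-- The weight `x ↦ exp (k x)`. -/
def expWeight (k : ℝ) : C(unitInterval, ℂ) := ⟨fun x => Complex.exp (k * x), by fun_prop⟩

theorem norm_expWeight (k : ℝ) (x : unitInterval) : ‖expWeight k x‖ = Real.exp (k * x) := by
  simp [expWeight, Complex.norm_exp]

theorem norm_primitive_mulL2_le {P : ℝ → ℂ} (hP : MemLp P 2 unitMeasure)
    (u : C(unitInterval, ℂ)) {x : ℝ} (hx : x ∈ Icc (0 : ℝ) 1) {B : ℝ}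
    (hB : ∀ t ∈ Icc (0 : ℝ) x, ‖ext u t‖ ≤ B) :
    ‖ext (primitive (mulL2 P hP u)) x‖ ≤ (∫ t, ‖P t‖ ∂unitMeasure) * B := by
  have hi : Integrable P unitMeasure := hP.integrable (by norm_num)
  have hB0 : 0 ≤ B := (norm_nonneg _).trans (hB 0 ⟨le_rfl, hx.1⟩)
  have hi' : IntegrableOn (fun t => ‖P t‖) (Ioc 0 x) := hi.norm.mono_measure
    (Measure.restrict_mono (Ioc_subset_Ioc_right hx.2) le_rfl)
  rw [ext_of_mem _ hx, primitive_apply, intervalIntegral_congr_unit (coeFn_mulL2 hP u) hx]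
  refine (intervalIntegral.norm_integral_le_integral_norm hx.1).trans ?_
  rw [intervalIntegral.integral_of_le hx.1]
  calc ∫ t in Ioc 0 x, ‖P t * ext u t‖ ≤ ∫ t in Ioc 0 x, ‖P t‖ * B := by
        refine setIntegral_mono_on ?_ (hi'.mul_const B) measurableSet_Ioc fun t ht => ?_
        · exact (((memLp_mul_ext hP u).integrable (by norm_num)).mono_measure
            (Measure.restrict_mono (Ioc_subset_Ioc_right hx.2) le_rfl)).norm
        · rw [norm_mul]
          gcongr
          exact hB t ⟨ht.1.le, ht.2⟩
    _ = (∫ t in Ioc 0 x, ‖P t‖) * B := integral_mul_const _ _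
    _ ≤ _ := by
        refine mul_le_mul_of_nonneg_right ?_ hB0
        exact setIntegral_mono_set hi.norm (Filter.Eventually.of_forall fun _ => norm_nonneg _)
          (Ioc_subset_Ioc_right hx.2).eventuallyLE

/-- Conjugation by `exp (k x)` with `k` large makes the Volterra operator a strict contraction. -/
theorem norm_conj_volterra_le {P : ℝ → ℂ} (hP : MemLp P 2 unitMeasure) {k : ℝ} (hk : 0 < k)
    (v : C(unitInterval, ℂ)) :
    ‖expWeight (-k) * volterra P hP (expWeight k * v)‖
      ≤ (∫ t, ‖P t‖ ∂unitMeasure) / k * ‖v‖ := by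
  have hI : 0 ≤ ∫ t, ‖P t‖ ∂unitMeasure := integral_nonneg fun _ => norm_nonneg _
  rw [ContinuousMap.norm_le _ (by positivity)]
  intro x
  have hinner : ∀ s ∈ Icc (0 : ℝ) x, ‖ext (primitive (mulL2 P hP (expWeight k * v))) s‖
      ≤ (∫ t, ‖P t‖ ∂unitMeasure) * (Real.exp (k * s) * ‖v‖) := by
    intro s hs
    refine norm_primitive_mulL2_le hP _ ⟨hs.1, hs.2.trans x.2.2⟩ fun t ht => ?_
    rw [ext_of_mem _ ⟨ht.1, ht.2.trans (hs.2.trans x.2.2)⟩, ContinuousMap.mul_apply, norm_mul,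
      norm_expWeight]
    gcongr
    · exact ht.2
    · exact v.norm_coe_le_norm _
  have hexp : ∫ s in (0 : ℝ)..x, Real.exp (k * s) ≤ Real.exp (k * x) / k := by
    rw [intervalIntegral.integral_comp_mul_left (fun s => Real.exp s) hk.ne', integral_exp,
      smul_eq_mul, div_eq_inv_mul]
    gcongr
    linarith [Real.exp_pos (k * 0)]
  rw [ContinuousMap.mul_apply, norm_mul, norm_expWeight, volterra_apply]
  calc Real.exp (-k * x) * ‖∫ s in (0 : ℝ)..x, ext (primitive (mulL2 P hP (expWeight k * v))) s‖
      ≤ Real.exp (-k * x) * ∫ s in (0 : ℝ)..x,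
          (∫ t, ‖P t‖ ∂unitMeasure) * (Real.exp (k * s) * ‖v‖) := by
        gcongr
        refine intervalIntegral.norm_integral_le_of_norm_le x.2.1
          (Filter.Eventually.of_forall fun s hs => hinner s ⟨hs.1.le, hs.2⟩) ?_
        exact Continuous.intervalIntegrable (by fun_prop) _ _
    _ = Real.exp (-k * x) *
          ((∫ t, ‖P t‖ ∂unitMeasure) * ((∫ s in (0 : ℝ)..x, Real.exp (k * s)) * ‖v‖)) := by
        rw [intervalIntegral.integral_const_mul, intervalIntegral.integral_mul_const]
    _ ≤ Real.exp (-k * x) *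
          ((∫ t, ‖P t‖ ∂unitMeasure) * (Real.exp (k * x) / k * ‖v‖)) := by
        gcongr
    _ = (Real.exp (-k * x) * Real.exp (k * x)) * ((∫ t, ‖P t‖ ∂unitMeasure) / k * ‖v‖) := by
        ring
    _ = _ := by
        rw [← Real.exp_add]
        simp

theorem isUnit_one_sub_volterra {P : ℝ → ℂ} (hP : MemLp P 2 unitMeasure) :
    IsUnit (1 - volterra P hP) := by
  set K := ∫ t, ‖P t‖ ∂unitMeasure
  have hK : 0 ≤ K := integral_nonneg fun _ => norm_nonneg _
  set k := 2 * K + 1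
  have hk : 0 < k := by positivity
  have hmul : ∀ l : ℝ, expWeight (-l) * expWeight l = 1 := fun l => by
    ext x
    simp [expWeight, ← Complex.exp_add]
  let W : (C(unitInterval, ℂ) →L[ℂ] C(unitInterval, ℂ))ˣ :=
    { val := ContinuousLinearMap.mul ℂ _ (expWeight k)
      inv := ContinuousLinearMap.mul ℂ _ (expWeight (-k))
      val_inv := by
        ext1 u
        change expWeight k * (expWeight (-k) * u) = u
        rw [← mul_assoc, mul_comm (expWeight k), hmul, one_mul]
      inv_val := by
        ext1 u
        change expWeight (-k) * (expWeight k * u) = u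
        rw [← mul_assoc, hmul, one_mul] }
  let T : C(unitInterval, ℂ) →L[ℂ] C(unitInterval, ℂ) := ↑W⁻¹ * volterra P hP * ↑W
  have hlt : ‖T‖ < 1 := by
    refine lt_of_le_of_lt (ContinuousLinearMap.opNorm_le_bound _ (by positivity)
      (norm_conj_volterra_le hP hk)) ?_
    rw [div_lt_one hk]
    linarith
  have h1 : IsUnit (1 - T) := by
    rw [← Units.val_oneSub T hlt]
    exact Units.isUnit _
  have h2 : (1 - volterra P hP) = ↑W * (1 - T) * ↑W⁻¹ := by
    have hW : ∀ u, (↑W : C(unitInterval, ℂ) →L[ℂ] C(unitInterval, ℂ))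
        ((↑W⁻¹ : C(unitInterval, ℂ) →L[ℂ] C(unitInterval, ℂ)) u) = u := fun u =>
      DFunLike.congr_fun W.mul_inv u
    ext1 u
    let W' : C(unitInterval, ℂ) →L[ℂ] C(unitInterval, ℂ) := ↑W⁻¹
    change u - volterra P hP u = (↑W : C(unitInterval, ℂ) →L[ℂ] C(unitInterval, ℂ))
      (W' u - W' (volterra P hP ((↑W : C(unitInterval, ℂ) →L[ℂ] C(unitInterval, ℂ)) (W' u))))
    rw [map_sub, hW, hW]
  rw [h2]
  exact (W.isUnit.mul h1).mul W⁻¹.isUnit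

theorem incl_congr {u : C(unitInterval, ℂ)} {f : EdgeL2} {v : ℝ → ℂ} (hf : f =ᵐ[unitMeasure] v)
    (h : ∀ x ∈ Icc (0 : ℝ) 1, v x = ext u x) : f = incl u := by
  refine Lp.ext ?_
  filter_upwards [hf, coeFn_incl u, ae_restrict_mem measurableSet_Ioc] with x h1 h2 h3
  rw [h1, h2, h x ⟨h3.1.le, h3.2⟩]

/-- The derivative with value `β` at `0` of a function with second derivative `w`. -/
def slope (β : ℂ) (w : EdgeL2) : C(unitInterval, ℂ) := β • 1 + primitive w

/-- The function with second derivative `w`, value `α` and slope `β` at `0`. -/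
def displ (α β : ℂ) (w : EdgeL2) : C(unitInterval, ℂ) := α • 1 + primitive (incl (slope β w))

theorem ext_slope (β : ℂ) (w : EdgeL2) {x : ℝ} (hx : x ∈ Icc (0 : ℝ) 1) :
    ext (slope β w) x = β + ∫ t in (0 : ℝ)..x, w t := by
  rw [ext_of_mem _ hx, slope]
  simp [primitive_apply]

theorem ext_displ (α β : ℂ) (w : EdgeL2) {x : ℝ} (hx : x ∈ Icc (0 : ℝ) 1) :
    ext (displ α β w) x = α + ∫ t in (0 : ℝ)..x, ext (slope β w) t := by
  rw [ext_of_mem _ hx, displ, ← intervalIntegral_congr_unit (coeFn_incl _) hx]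
  simp [primitive_apply]

theorem ext_slope_zero (β : ℂ) (w : EdgeL2) : ext (slope β w) 0 = β := by
  rw [ext_slope β w (by simp)]
  simp

theorem ext_displ_zero (α β : ℂ) (w : EdgeL2) : ext (displ α β w) 0 = α := by
  rw [ext_displ α β w (by simp)]
  simp

theorem isH2_displ (α β : ℂ) (w : EdgeL2) :
    IsH2 (incl (displ α β w)) (ext (displ α β w)) (ext (slope β w)) w where
  ae_eq := coeFn_incl _
  eq_integral x hx := by rw [ext_displ_zero, ext_displ α β w hx]
  deriv_eq_integral x hx := by rw [ext_slope_zero, ext_slope β w hx]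

namespace IsH2

variable {f : EdgeL2} {u du : ℝ → ℂ} {w : EdgeL2}

theorem du_eq (h : IsH2 f u du w) {x : ℝ} (hx : x ∈ Icc (0 : ℝ) 1) :
    du x = ext (slope (du 0) w) x := by
  rw [h.deriv_eq_integral x hx, ext_slope _ _ hx]

theorem u_eq (h : IsH2 f u du w) {x : ℝ} (hx : x ∈ Icc (0 : ℝ) 1) :
    u x = ext (displ (u 0) (du 0) w) x := by
  rw [h.eq_integral x hx, ext_displ _ _ _ hx]
  congr 1
  refine intervalIntegral.integral_congr fun t ht => h.du_eq ?_
  rw [uIcc_of_le hx.1] at ht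
  exact ⟨ht.1, ht.2.trans hx.2⟩

theorem eq_incl (h : IsH2 f u du w) : f = incl (displ (u 0) (du 0) w) :=
  incl_congr h.ae_eq fun _ hx => h.u_eq hx

end IsH2

/-- The solution of `u'' = P u - G` with value `α` and slope `β` at `0`, as a bounded operator
of `((α, β), G)`. -/
def solution (P : ℝ → ℂ) (hP : MemLp P 2 unitMeasure) :
    (ℂ × ℂ) × EdgeL2 →L[ℂ] C(unitInterval, ℂ) :=
  Ring.inverse (1 - volterra P hP) ∘L
    (((ContinuousLinearMap.fst ℂ ℂ ℂ).smulRight (1 : C(unitInterval, ℂ)) +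
        (ContinuousLinearMap.snd ℂ ℂ ℂ).smulRight (primitive (incl 1))) ∘L
          ContinuousLinearMap.fst ℂ (ℂ × ℂ) EdgeL2 -
      (primitive ∘L incl ∘L primitive) ∘L ContinuousLinearMap.snd ℂ (ℂ × ℂ) EdgeL2)

variable {P : ℝ → ℂ} (hP : MemLp P 2 unitMeasure)

theorem eq_solution_iff (u : C(unitInterval, ℂ)) (α β : ℂ) (G : EdgeL2) :
    u = solution P hP ((α, β), G) ↔ u = displ α β (mulL2 P hP u - G) := by
  have hR := isUnit_one_sub_volterra hP
  have h1 : u = solution P hP ((α, β), G) ↔ (1 - volterra P hP) u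
      = α • 1 + β • primitive (incl 1) - primitive (incl (primitive G)) := by
    have hd : solution P hP ((α, β), G) = Ring.inverse (1 - volterra P hP)
      (α • 1 + β • primitive (incl 1) - primitive (incl (primitive G))) := rfl
    rw [hd]
    constructor
    · intro h
      rw [h, ← mul_apply_eq_comp, Ring.mul_inverse_cancel _ hR,
        one_apply_eq_self]
    · intro h
      rw [← h, ← mul_apply_eq_comp, Ring.inverse_mul_cancel _ hR,
        one_apply_eq_self]
  have h2 : (1 - volterra P hP) u = u - primitive (incl (primitive (mulL2 P hP u))) := rfl
  rw [h1, h2, displ, slope, map_add, map_add, map_sub, map_sub, map_sub, map_smul, map_smul]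
  constructor <;> intro h
  · linear_combination (exp := 1) h
  · linear_combination (exp := 1) h

theorem solution_eq (α β : ℂ) (G : EdgeL2) : solution P hP ((α, β), G)
    = displ α β (mulL2 P hP (solution P hP ((α, β), G)) - G) :=
  (eq_solution_iff hP _ α β G).1 rfl

/-- The second derivative `P u - G` of the solution. -/
def secondDeriv (P : ℝ → ℂ) (hP : MemLp P 2 unitMeasure) : (ℂ × ℂ) × EdgeL2 →L[ℂ] EdgeL2 :=
  mulL2 P hP ∘L solution P hP - ContinuousLinearMap.snd ℂ (ℂ × ℂ) EdgeL2

theorem solution_eq_displ (p : (ℂ × ℂ) × EdgeL2) :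
    solution P hP p = displ p.1.1 p.1.2 (secondDeriv P hP p) :=
  solution_eq hP p.1.1 p.1.2 p.2

theorem isH2_solution (p : (ℂ × ℂ) × EdgeL2) :
    IsH2 (incl (solution P hP p)) (ext (solution P hP p))
      (ext (slope p.1.2 (secondDeriv P hP p))) (secondDeriv P hP p) := by
  have h := isH2_displ p.1.1 p.1.2 (secondDeriv P hP p)
  rwa [← solution_eq_displ hP p] at h

theorem ext_solution_zero (p : (ℂ × ℂ) × EdgeL2) : ext (solution P hP p) 0 = p.1.1 := by
  rw [solution_eq_displ hP p, ext_displ_zero]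

theorem coeFn_secondDeriv (p : (ℂ × ℂ) × EdgeL2) : secondDeriv P hP p =ᵐ[unitMeasure]
    fun x => P x * ext (solution P hP p) x - p.2 x := by
  have h : secondDeriv P hP p = mulL2 P hP (solution P hP p) - p.2 := rfl
  rw [h]
  filter_upwards [Lp.coeFn_sub (mulL2 P hP (solution P hP p)) p.2,
    coeFn_mulL2 hP (solution P hP p)] with x h1 h2
  rw [h1, Pi.sub_apply, h2]

/-- Uniqueness for the initial value problem. -/
theorem IsH2.eq_solution {f G w : EdgeL2} {u du : ℝ → ℂ} (h : IsH2 f u du w)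
    (hw : w =ᵐ[unitMeasure] fun x => P x * u x - G x) :
    displ (u 0) (du 0) w = solution P hP ((u 0, du 0), G) ∧
      w = secondDeriv P hP ((u 0, du 0), G) := by
  set v := displ (u 0) (du 0) w with hv
  have hw' : w = mulL2 P hP v - G := by
    refine Lp.ext ?_
    filter_upwards [hw, Lp.coeFn_sub (mulL2 P hP v) G, coeFn_mulL2 hP v,
      ae_restrict_mem measurableSet_Ioc] with x h1 h2 h3 h4
    rw [h1, h2, Pi.sub_apply, h3, h.u_eq ⟨h4.1.le, h4.2⟩]
  have h1 : v = solution P hP ((u 0, du 0), G) := by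
    rw [eq_solution_iff, ← hw']
  refine ⟨h1, ?_⟩
  rw [hw', h1]
  rfl

/-! ### The Wronskian -/

theorem _root_.AbsolutelyContinuousOnInterval.congr {X : Type*} [PseudoMetricSpace X]
    {f g : ℝ → X} {a b : ℝ} (hf : AbsolutelyContinuousOnInterval f a b)
    (h : EqOn f g (uIcc a b)) : AbsolutelyContinuousOnInterval g a b := by
  unfold AbsolutelyContinuousOnInterval at hf ⊢
  refine hf.congr' ?_
  rw [Filter.EventuallyEq, Filter.eventually_inf_principal]
  filter_upwards with E hE
  refine Finset.sum_congr rfl fun i hi => ?_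
  rw [h (hE.1 i hi).1, h (hE.1 i hi).2]

theorem absolutelyContinuousOnInterval_primitive {g : ℝ → ℂ} (c : ℂ)
    (hg : IntervalIntegrable g volume 0 1) :
    AbsolutelyContinuousOnInterval (fun x => c + ∫ t in (0 : ℝ)..x, g t) 0 1 := by
  have hre := (show IntervalIntegrable (fun t => (g t).re) volume 0 1 from
    ⟨hg.1.re, hg.2.re⟩).absolutelyContinuousOnInterval_intervalIntegral (c := 0) (by simp)
  have him := (show IntervalIntegrable (fun t => (g t).im) volume 0 1 from
    ⟨hg.1.im, hg.2.im⟩).absolutelyContinuousOnInterval_intervalIntegral (c := 0) (by simp)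
  have hconst : ∀ d : ℂ, AbsolutelyContinuousOnInterval (fun _ : ℝ => d) 0 1 := fun d =>
    (LipschitzWith.const d).lipschitzOnWith.absolutelyContinuousOnInterval (K := 0)
  have h := (hconst c).add ((hre.smul (hconst 1)).add (him.smul (hconst Complex.I)))
  refine h.congr fun x hx => ?_
  rw [uIcc_of_le zero_le_one] at hx
  have hgx : IntervalIntegrable g volume 0 x := hg.mono_set (by
    rw [uIcc_of_le hx.1, uIcc_of_le zero_le_one]
    exact Icc_subset_Icc_right hx.2)
  have h1 : ∫ t in (0 : ℝ)..x, (g t).re = (∫ t in (0 : ℝ)..x, g t).re :=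
    Complex.reCLM.intervalIntegral_comp_comm hgx
  have h2 : ∫ t in (0 : ℝ)..x, (g t).im = (∫ t in (0 : ℝ)..x, g t).im :=
    Complex.imCLM.intervalIntegral_comp_comm hgx
  simp only [Pi.add_apply, Pi.smul_apply', h1, h2]
  rw [Complex.real_smul, Complex.real_smul, mul_one, Complex.re_add_im]

/-- The Wronskian of two solutions of `u'' = P u` has the same value at both ends. -/
theorem wronskian_eq {f₁ f₂ w₁ w₂ : EdgeL2} {u₁ du₁ u₂ du₂ : ℝ → ℂ}
    (h₁ : IsH2 f₁ u₁ du₁ w₁) (h₂ : IsH2 f₂ u₂ du₂ w₂)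
    (hw₁ : w₁ =ᵐ[unitMeasure] fun x => P x * u₁ x) (hw₂ : w₂ =ᵐ[unitMeasure] fun x => P x * u₂ x) :
    du₁ 0 * u₂ 0 - u₁ 0 * du₂ 0 = du₁ 1 * u₂ 1 - u₁ 1 * du₂ 1 := by
  have i₁ := h₁.intervalIntegrable_du (x := 1) (by simp)
  have i₂ := h₂.intervalIntegrable_du (x := 1) (by simp)
  have j₁ := edgeL2_intervalIntegrable w₁ (x := 1) (by simp)
  have j₂ := edgeL2_intervalIntegrable w₂ (x := 1) (by simp)
  have hac := ((absolutelyContinuousOnInterval_primitive (du₁ 0) j₁).smul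
    (absolutelyContinuousOnInterval_primitive (u₂ 0) i₂)).sub
    ((absolutelyContinuousOnInterval_primitive (u₁ 0) i₁).smul
    (absolutelyContinuousOnInterval_primitive (du₂ 0) j₂))
  have hae : ∀ᵐ x : ℝ, x ∈ Ioc (0 : ℝ) 1 → w₁ x = P x * u₁ x ∧ w₂ x = P x * u₂ x := by
    rw [← ae_restrict_iff' measurableSet_Ioc]
    exact hw₁.and hw₂
  have hne : ∀ᵐ x : ℝ, x ≠ 0 := by simp [ae_iff]
  obtain ⟨C, hC⟩ := hac.const_of_ae_hasDerivAt_zero (by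
    filter_upwards [i₁.ae_hasDerivAt_integral, i₂.ae_hasDerivAt_integral,
      j₁.ae_hasDerivAt_integral, j₂.ae_hasDerivAt_integral, hae, hne] with x a₁ a₂ b₁ b₂ e h0 hx
    have hx' := hx
    rw [uIcc_of_le zero_le_one] at hx'
    have hm : (0 : ℝ) ∈ uIcc (0 : ℝ) 1 := by simp
    have e' := e ⟨lt_of_le_of_ne hx'.1 (Ne.symm h0), hx'.2⟩
    have := (((b₁ hx 0 hm).const_add (du₁ 0)).mul ((a₂ hx 0 hm).const_add (u₂ 0))).sub
      (((a₁ hx 0 hm).const_add (u₁ 0)).mul ((b₂ hx 0 hm).const_add (du₂ 0)))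
    refine this.congr_deriv ?_
    rw [← h₁.eq_integral x hx', ← h₂.eq_integral x hx', ← h₁.deriv_eq_integral x hx',
      ← h₂.deriv_eq_integral x hx', e'.1, e'.2]
    ring)
  have c0 := hC 0 (by simp)
  have c1 := hC 1 (by simp)
  simp only [Pi.sub_apply, smul_eq_mul, Pi.mul_apply] at c0 c1
  rw [← h₁.eq_integral 1 (by simp), ← h₂.eq_integral 1 (by simp),
    ← h₁.deriv_eq_integral 1 (by simp), ← h₂.deriv_eq_integral 1 (by simp)] at c1
  simp only [intervalIntegral.integral_same, add_zero] at c0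
  rw [c0, c1]

/-! ### The spectrum of the edge operator -/

/-- The coefficient `P = (q - z) / a` for which `-a u'' + q u = z u` reads `u'' = P u`. -/
def edgeCoeff (a : ℝ) (q : ℝ → ℝ) (z : ℂ) (x : ℝ) : ℂ := (a : ℂ)⁻¹ * ((q x : ℂ) - z)

theorem memLp_edgeCoeff {q : ℝ → ℝ} (a : ℝ) (hq : MemLp q 2 unitMeasure) (z : ℂ) :
    MemLp (edgeCoeff a q z) 2 unitMeasure :=
  (hq.ofReal.sub (memLp_const z)).const_mul _

theorem edgeCoeff_eq_iff {a : ℝ} (ha : 0 < a) (q : ℝ → ℝ) (z d u g : ℂ) (x : ℝ) :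
    d = edgeCoeff a q z x * u - (a : ℂ)⁻¹ * g ↔ g + z * u = -(a : ℂ) * d + (q x : ℂ) * u := by
  have ha' : (a : ℂ) ≠ 0 := by exact_mod_cast ha.ne'
  have h : (a : ℂ) * (a : ℂ)⁻¹ = 1 := mul_inv_cancel₀ ha'
  rw [edgeCoeff]
  constructor <;> intro e
  · linear_combination (a : ℂ) * e + ((q x - z) * u - g) * h
  · linear_combination (a : ℂ)⁻¹ * e - d * h

/-- `f`, with representative `u` and derivatives `du`, `w`, solves `u'' = P u` and satisfies the
Robin conditions `u(0) - s u'(0) = 0` and `u(1) + s u'(1) = 0`; it is normalised by `u'(0) = 1`,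
which is no restriction on a nonzero solution. -/
structure IsRobinSolution (P : ℝ → ℂ) (s : ℂ) (f : EdgeL2) (u du : ℝ → ℂ) (w : EdgeL2) :
    Prop where
  isH2 : IsH2 f u du w
  eq : w =ᵐ[unitMeasure] fun x => P x * u x
  u_zero : u 0 = s
  du_zero : du 0 = 1
  robin_one : u 1 + s * du 1 = 0

/-- The boundary value `u(1) + s u'(1)` of the solution with given initial data and right-hand
side. -/
def robinAtOne (P : ℝ → ℂ) (hP : MemLp P 2 unitMeasure) (s : ℂ) : (ℂ × ℂ) × EdgeL2 →L[ℂ] ℂ :=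
  ContinuousMap.evalCLM ℂ (1 : unitInterval) ∘L solution P hP +
    s • (ContinuousLinearMap.snd ℂ ℂ ℂ ∘L ContinuousLinearMap.fst ℂ (ℂ × ℂ) EdgeL2 +
      ContinuousMap.evalCLM ℂ (1 : unitInterval) ∘L primitive ∘L secondDeriv P hP)

theorem robinAtOne_apply (s : ℂ) (p : (ℂ × ℂ) × EdgeL2) : robinAtOne P hP s p =
    ext (solution P hP p) 1 + s * ext (slope p.1.2 (secondDeriv P hP p)) 1 := by
  rw [ext_of_mem _ (by simp), ext_of_mem _ (by simp)]
  have : slope p.1.2 (secondDeriv P hP p) ⟨1, by simp⟩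
      = p.1.2 + primitive (secondDeriv P hP p) 1 := by
    simp only [slope, ContinuousMap.add_apply, ContinuousMap.smul_apply, ContinuousMap.one_apply,
      smul_eq_mul, mul_one]
    rfl
  rw [this]
  rfl

theorem isRobinSolution_solution {s : ℂ} (h : robinAtOne P hP s ((s, 1), 0) = 0) :
    IsRobinSolution P s (incl (solution P hP ((s, 1), 0))) (ext (solution P hP ((s, 1), 0)))
      (ext (slope 1 (secondDeriv P hP ((s, 1), 0)))) (secondDeriv P hP ((s, 1), 0)) where
  isH2 := isH2_solution hP ((s, 1), 0)
  eq := by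
    filter_upwards [coeFn_secondDeriv hP ((s, 1), 0), Lp.coeFn_zero ℂ 2 unitMeasure] with x h1 h2
    rw [h1, h2]
    simp
  u_zero := ext_solution_zero hP ((s, 1), 0)
  du_zero := ext_slope_zero _ _
  robin_one := by rwa [← robinAtOne_apply hP s ((s, 1), 0)]

/-- The initial data at `0` for which the solution with right-hand side `a⁻¹ g` satisfies both
Robin conditions, together with that right-hand side; see `robinAtOne_robinData`. -/
def robinData (P : ℝ → ℂ) (hP : MemLp P 2 unitMeasure) (s : ℂ) (a : ℝ) :
    EdgeL2 →L[ℂ] (ℂ × ℂ) × EdgeL2 :=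
  ((-(robinAtOne P hP s ((s, 1), 0))⁻¹ * (a : ℂ)⁻¹) •
      (robinAtOne P hP s ∘L ContinuousLinearMap.inr ℂ (ℂ × ℂ) EdgeL2)).smulRight ((s, 1), 0) +
    (a : ℂ)⁻¹ • ContinuousLinearMap.inr ℂ (ℂ × ℂ) EdgeL2

theorem robinData_apply (s : ℂ) (a : ℝ) (g : EdgeL2) : robinData P hP s a g =
    ((-(robinAtOne P hP s ((s, 1), 0))⁻¹ * robinAtOne P hP s (0, (a : ℂ)⁻¹ • g)) •
      ((s, 1), 0) + (0, (a : ℂ)⁻¹ • g) : (ℂ × ℂ) × EdgeL2) := by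
  have h : ((0, (a : ℂ)⁻¹ • g) : (ℂ × ℂ) × EdgeL2) = (a : ℂ)⁻¹ • (0, g) := by simp
  rw [h, map_smul, smul_eq_mul, ← mul_assoc]
  rfl

theorem robinAtOne_robinData {s : ℂ} (hD : robinAtOne P hP s ((s, 1), 0) ≠ 0) (a : ℝ)
    (g : EdgeL2) : robinAtOne P hP s (robinData P hP s a g) = 0 := by
  rw [robinData_apply, map_add, map_smul, smul_eq_mul]
  field_simp
  ring

/-- Uniqueness of the initial data in `robinData`. -/
theorem eq_robinData {s : ℂ} (hD : robinAtOne P hP s ((s, 1), 0) ≠ 0) {a : ℝ} {g : EdgeL2}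
    {β : ℂ} (h : robinAtOne P hP s ((s * β, β), (a : ℂ)⁻¹ • g) = 0) :
    ((s * β, β), (a : ℂ)⁻¹ • g) = robinData P hP s a g := by
  have h1 : (((s * β, β), (a : ℂ)⁻¹ • g) : (ℂ × ℂ) × EdgeL2)
      = β • ((s, 1), 0) + (0, (a : ℂ)⁻¹ • g) := by
    simp [mul_comm]
  rw [h1] at h
  rw [map_add, map_smul, smul_eq_mul] at h
  rw [h1, robinData_apply]
  congr 2
  rw [neg_mul, inv_mul_eq_div, ← neg_div, eq_div_iff hD]
  linear_combination h

/-- A point of the spectrum of the edge operator is an eigenvalue: otherwise solving the Robin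
problem by `robinData` gives a bounded inverse. -/
theorem exists_isRobinSolution {a : ℝ} (ha : 0 < a) {κinv : ℝ≥0} {q : ℝ → ℝ}
    (hq : MemLp q 2 unitMeasure) {z : ℂ} (hz : z ∈ Sigma0 a κinv q) :
    ∃ f u du w, IsRobinSolution (edgeCoeff a q z) ((a : ℂ) * (κinv : ℂ)) f u du w := by
  have hP := memLp_edgeCoeff a hq z
  set s : ℂ := (a : ℂ) * (κinv : ℂ) with hs
  by_cases hD : robinAtOne _ hP s ((s, 1), 0) = 0
  · exact ⟨_, _, _, _, isRobinSolution_solution hP hD⟩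
  refine absurd ?_ hz
  refine ⟨incl ∘L solution _ hP ∘L robinData _ hP s a, fun x => ?_, fun g => ?_⟩
  · have hx : ((x : EdgeL2), edgeOperator a κinv q x) ∈ edgeGraph a κinv q := by
      rw [← graph_edgeOperator]
      exact LinearPMap.mem_graph _ x
    obtain ⟨u, du, w, h, hT, h0, h1⟩ := hx
    set g := edgeOperator a κinv q x - z • (x : EdgeL2) with hg
    have hw : w =ᵐ[unitMeasure] fun t => edgeCoeff a q z t * u t - ((a : ℂ)⁻¹ • g : EdgeL2) t := by
      filter_upwards [hT, h.ae_eq, Lp.coeFn_smul (a : ℂ)⁻¹ g,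
        Lp.coeFn_sub (edgeOperator a κinv q x) (z • (x : EdgeL2)),
        Lp.coeFn_smul z (x : EdgeL2)] with t e1 e2 e3 e4 e5
      change edgeOperator a κinv q x t = _ at e1
      change (x : EdgeL2) t = _ at e2
      rw [e3, Pi.smul_apply, smul_eq_mul, edgeCoeff_eq_iff ha, hg, e4, Pi.sub_apply, e5,
        Pi.smul_apply, smul_eq_mul, e1, e2]
      ring
    obtain ⟨e1, e2⟩ := h.eq_solution hP hw
    have hu0 : u 0 = s * du 0 := sub_eq_zero.1 h0
    have hx' : (x : EdgeL2) = incl (solution _ hP ((s * du 0, du 0), (a : ℂ)⁻¹ • g)) := by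
      rw [← hu0, ← e1]
      exact h.eq_incl
    have hr : robinAtOne _ hP s ((s * du 0, du 0), (a : ℂ)⁻¹ • g) = 0 := by
      rw [robinAtOne_apply, ← hu0, ← e1, ← e2, ← h.u_eq (by simp), ← h.du_eq (by simp)]
      exact h1
    rw [eq_robinData hP hD hr] at hx'
    exact hx'.symm
  · set p := robinData _ hP s a g with hp
    set f := incl (solution _ hP p) with hf
    have hp1 : p.1.1 = s * p.1.2 := by
      rw [hp, robinData_apply]
      simp [mul_comm]
    have hp2 : p.2 = (a : ℂ)⁻¹ • g := by
      rw [hp, robinData_apply]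
      simp
    have hmem : (f, g + z • f) ∈ (edgeOperator a κinv q).graph := by
      rw [graph_edgeOperator]
      refine ⟨_, _, _, isH2_solution hP p, ?_, ?_, ?_⟩
      · filter_upwards [coeFn_secondDeriv hP p, coeFn_incl (solution _ hP p),
          Lp.coeFn_smul (a : ℂ)⁻¹ g, Lp.coeFn_add g (z • f), Lp.coeFn_smul z f]
          with t e1 e2 e3 e4 e5
        rw [hp2, e3, Pi.smul_apply, smul_eq_mul, edgeCoeff_eq_iff ha] at e1
        rw [← e1, e4, Pi.add_apply, e5, Pi.smul_apply, smul_eq_mul, hf, e2]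
      · rw [ext_solution_zero, ext_slope_zero, hp1]
        exact sub_self _
      · have := robinAtOne_robinData hP hD a g
        rwa [← hp, robinAtOne_apply] at this
    obtain ⟨x, hx1, hx2⟩ := (LinearPMap.mem_graph_iff _).1 hmem
    refine ⟨x, hx1, ?_⟩
    simp only at hx1 hx2
    rw [hx2, hx1, add_sub_cancel_right]

namespace IsRobinSolution

variable {s : ℂ} {f : EdgeL2} {u du : ℝ → ℂ} {w : EdgeL2}

theorem ne_zero (h : IsRobinSolution P s f u du w) : f ≠ 0 := by
  rintro rfl
  have := (h.isH2.of_eq_zero).2.1 0 (by simp)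
  rw [h.du_zero] at this
  exact one_ne_zero this

/-- Otherwise the Wronskian with the solution that has value `1` and slope `0` at `0` would
vanish at `1`, but not at `0`. -/
theorem du_one_ne_zero (hP : MemLp P 2 unitMeasure) (h : IsRobinSolution P s f u du w) :
    du 1 ≠ 0 := by
  intro h1
  have hu1 : u 1 = 0 := by simpa [h1] using h.robin_one
  have := wronskian_eq h.isH2 (isH2_solution hP ((1, 0), 0)) h.eq (by
    filter_upwards [coeFn_secondDeriv hP ((1, 0), 0), Lp.coeFn_zero ℂ 2 unitMeasure]
      with x h1 h2
    rw [h1, h2]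
    simp)
  rw [h1, hu1, h.du_zero, ext_solution_zero, ext_slope_zero] at this
  simp at this

/-- The boundary displacements of any solution of the same equation are proportional to the slopes
of the Robin solution at the opposite ends. -/
theorem displacement_mul_eq (h : IsRobinSolution P s f u du w) {g v : EdgeL2} {y dy : ℝ → ℂ}
    (hy : IsH2 g y dy v) (hv : v =ᵐ[unitMeasure] fun x => P x * y x) :
    y 0 - s * dy 0 = (y 1 + s * dy 1) * du 1 := by
  have := wronskian_eq h.isH2 hy h.eq hv
  rw [h.du_zero, h.u_zero] at this
  linear_combination this - dy 1 * h.robin_one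

/-- A solution of the same equation with Robin condition at `0` is a multiple. -/
theorem eq_smul (hP : MemLp P 2 unitMeasure) (h : IsRobinSolution P s f u du w) {g v : EdgeL2}
    {y dy : ℝ → ℂ} (hy : IsH2 g y dy v) (hv : v =ᵐ[unitMeasure] fun x => P x * y x)
    (h0 : y 0 - s * dy 0 = 0) : g = dy 0 • f ∧ dy 1 = dy 0 * du 1 := by
  have key : ∀ {g v : EdgeL2} {y dy : ℝ → ℂ}, IsH2 g y dy v →
      (v =ᵐ[unitMeasure] fun x => P x * y x) →
      displ (y 0) (dy 0) v = solution P hP ((y 0, dy 0), 0) ∧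
        v = secondDeriv P hP ((y 0, dy 0), 0) := by
    intro g v y dy hy hv
    refine hy.eq_solution hP ?_
    filter_upwards [hv, Lp.coeFn_zero ℂ 2 unitMeasure] with x e1 e2
    rw [e1, e2]
    simp
  obtain ⟨a1, a2⟩ := key hy hv
  obtain ⟨b1, b2⟩ := key h.isH2 h.eq
  have hp : (((y 0, dy 0), 0) : (ℂ × ℂ) × EdgeL2) = dy 0 • ((u 0, du 0), 0) := by
    rw [h.u_zero, h.du_zero, sub_eq_zero.1 h0]
    simp [mul_comm]
  rw [hp, map_smul] at a1 a2
  rw [← b1] at a1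
  rw [← b2] at a2
  constructor
  · rw [hy.eq_incl, h.isH2.eq_incl, a1, map_smul]
  · have hs : slope (dy 0) v = dy 0 • slope (du 0) w := by
      rw [slope, slope, a2, h.du_zero, map_smul]
      ext x
      simp [mul_add]
    rw [hy.du_eq (by simp), h.isH2.du_eq (by simp), hs, ext_of_mem _ (by simp),
      ext_of_mem _ (by simp)]
    rfl

end IsRobinSolution

/-- The initial data of a solution are bounded by its `L²` norm. -/
theorem exists_norm_initial_le (hP : MemLp P 2 unitMeasure) : ∃ K : ℝ, ∀ (g v : EdgeL2)
    (y dy : ℝ → ℂ), IsH2 g y dy v → (v =ᵐ[unitMeasure] fun x => P x * y x) →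
    ‖y 0‖ ≤ K * ‖g‖ ∧ ‖dy 0‖ ≤ K * ‖g‖ := by
  let Φ : ℂ × ℂ →L[ℂ] EdgeL2 :=
    incl ∘L solution P hP ∘L ContinuousLinearMap.inl ℂ (ℂ × ℂ) EdgeL2
  have hker : LinearMap.ker (Φ : ℂ × ℂ →ₗ[ℂ] EdgeL2) = ⊥ := by
    refine LinearMap.ker_eq_bot'.2 fun p hp => ?_
    have h := isH2_solution hP (p, 0)
    have h' : incl (solution P hP (p, 0)) = 0 := hp
    rw [h'] at h
    obtain ⟨h1, h2, -⟩ := h.of_eq_zero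
    have h3 := h1 0 (by simp)
    have h4 := h2 0 (by simp)
    rw [ext_solution_zero] at h3
    rw [ext_slope_zero] at h4
    exact Prod.ext h3 h4
  obtain ⟨K, -, hK⟩ := LinearMap.exists_antilipschitzWith (Φ : ℂ × ℂ →ₗ[ℂ] EdgeL2) hker
  refine ⟨K, fun g v y dy hy hv => ?_⟩
  have hg : Φ (y 0, dy 0) = g := by
    have := (hy.eq_solution hP (G := 0) (by
      filter_upwards [hv, Lp.coeFn_zero ℂ 2 unitMeasure] with x e1 e2
      rw [e1, e2]
      simp)).1
    rw [hy.eq_incl, this]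
    rfl
  have hb : ‖(y 0, dy 0)‖ ≤ K * ‖g‖ := by
    rw [← hg]
    exact ZeroHomClass.bound_of_antilipschitz Φ hK _
  exact ⟨(norm_fst_le (y 0, dy 0)).trans hb, (norm_snd_le (y 0, dy 0)).trans hb⟩

/-! ### Flows on the hexagonal lattice -/

open Filter Topology

/-- A function on `ℤ²` that tends to zero at infinity vanishes along every ray on which its
modulus is constant. -/
theorem eq_zero_of_norm_const_ray {g : ℤ × ℤ → ℂ} (hg : Tendsto g cofinite (𝓝 0)) {n v : ℤ × ℤ}
    (hv : v ≠ 0) {M : ℝ} (h : ∀ k : ℕ, ‖g (n + k • v)‖ = M) : M = 0 := by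
  have hinj : Function.Injective fun k : ℕ => n + k • v := by
    intro k l hkl
    have hkl' : (k : ℤ) • v = (l : ℤ) • v := by simpa using hkl
    exact_mod_cast smul_left_injective ℤ hv hkl'
  have h1 := (hg.comp hinj.tendsto_cofinite).norm
  rw [norm_zero] at h1
  have h2 : (fun k : ℕ => ‖(g ∘ fun k : ℕ => n + k • v) k‖) = fun _ => M := funext h
  rw [h2] at h1
  exact tendsto_nhds_unique tendsto_const_nhds h1

theorem eq_zero_of_shift_invariant {g : ℤ × ℤ → ℂ} (hg : Tendsto g cofinite (𝓝 0)) {v : ℤ × ℤ}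
    (hv : v ≠ 0) (h : ∀ n, g (n + v) = g n) (n : ℤ × ℤ) : g n = 0 := by
  refine norm_eq_zero.1 (eq_zero_of_norm_const_ray hg hv (n := n) fun k => ?_)
  induction k with
  | zero => simp
  | succ k ih => rw [succ_nsmul, ← add_assoc, h, ih]

/-- The maximum principle on the triangular lattice: a harmonic function that tends to zero at
infinity is zero. -/
theorem eq_zero_of_harmonic {g : ℤ × ℤ → ℂ} (hg : Tendsto g cofinite (𝓝 0))
    (h : ∀ n, 6 * g n = g (n + (1, 0)) + g (n + (-1, 0)) + g (n + (0, 1)) + g (n + (0, -1)) +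
      g (n + (1, -1)) + g (n + (-1, 1))) (n : ℤ × ℤ) : g n = 0 := by
  by_contra hn
  have hfin : {m | ‖g n‖ ≤ ‖g m‖}.Finite := by
    have h1 : ∀ᶠ m in cofinite, ‖g m‖ < ‖g n‖ := by
      have := hg.norm
      rw [norm_zero] at this
      exact this.eventually_lt_const (norm_pos_iff.2 hn)
    simpa [Filter.eventually_cofinite] using h1
  obtain ⟨m, hm, hmax⟩ := Set.exists_max_image _ (fun m => ‖g m‖) hfin ⟨n, by simp⟩
  have hle : ∀ k, ‖g k‖ ≤ ‖g m‖ := fun k => by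
    by_cases hk : ‖g n‖ ≤ ‖g k‖
    · exact hmax k hk
    · exact (not_le.1 hk).le.trans hm
  have hstep : ∀ k, ‖g k‖ = ‖g m‖ → ‖g (k + (1, 0))‖ = ‖g m‖ := fun k hk => by
    refine le_antisymm (hle _) ?_
    have h6 : 6 * ‖g m‖ = ‖6 * g k‖ := by simp [hk]
    rw [h k] at h6
    have t1 := norm_add_le (g (k + (1, 0)) + g (k + (-1, 0)) + g (k + (0, 1)) + g (k + (0, -1)) +
      g (k + (1, -1))) (g (k + (-1, 1)))
    have t2 := norm_add_le (g (k + (1, 0)) + g (k + (-1, 0)) + g (k + (0, 1)) + g (k + (0, -1)))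
      (g (k + (1, -1)))
    have t3 := norm_add_le (g (k + (1, 0)) + g (k + (-1, 0)) + g (k + (0, 1))) (g (k + (0, -1)))
    have t4 := norm_add_le (g (k + (1, 0)) + g (k + (-1, 0))) (g (k + (0, 1)))
    have t5 := norm_add_le (g (k + (1, 0))) (g (k + (-1, 0)))
    linarith [hle (k + (-1, 0)), hle (k + (0, 1)), hle (k + (0, -1)), hle (k + (1, -1)),
      hle (k + (-1, 1))]
  have hM := eq_zero_of_norm_const_ray hg (n := m) (v := (1, 0)) (by simp) (M := ‖g m‖) fun k => by
    induction k with
    | zero => simp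
    | succ k ih => rw [succ_nsmul, ← add_assoc, hstep _ ih]
  have := hle n
  rw [hM] at this
  exact hn (norm_le_zero_iff.1 this)

/-- Kirchhoff's rule at all vertices. Since every edge joins the two classes of vertices, `c` is
then, up to orientation, a flow without sources. -/
def IsFlow (c : Edge → ℂ) : Prop :=
  (∀ n, ∑ i : Fin 3, c (n, i) = 0) ∧ ∀ n, ∑ i : Fin 3, c (n + shift i, i) = 0

/-- The alternating sum of `c` along the hexagon `n`. -/
def circulation (c : Edge → ℂ) (n : ℤ × ℤ) : ℂ :=
  c (n, 0) - c (n + (1, 0), 1) + c (n + (1, 0), 2) - c (n + (1, -1), 0) + c (n + (1, -1), 1)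
    - c (n, 2)

/-- A flow without circulation that tends to zero at infinity vanishes: its components are harmonic
on a triangular lattice. -/
theorem IsFlow.eq_zero {c : Edge → ℂ} (hc : IsFlow c) (hcirc : ∀ n, circulation c n = 0)
    (hlim : Tendsto c cofinite (𝓝 0)) : c = 0 := by
  have hlim' : ∀ i : Fin 3, Tendsto (fun n => c (n, i)) cofinite (𝓝 0) := fun i =>
    hlim.comp (Function.Injective.tendsto_cofinite fun _ _ h => (Prod.ext_iff.1 h).1)
  have hD : ∀ i j : ℤ, c ((i, j), 0) + c ((i, j), 1) + c ((i, j), 2) = 0 := fun i j => by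
    simpa [Fin.sum_univ_three] using hc.1 (i, j)
  have hD' : ∀ i j : ℤ, c ((i, j), 0) + c ((i + 1, j), 1) + c ((i, j + 1), 2) = 0 := fun i j => by
    simpa [Fin.sum_univ_three, shift] using hc.2 (i, j)
  have hC : ∀ i j : ℤ, c ((i, j), 0) - c ((i + 1, j), 1) + c ((i + 1, j), 2)
      - c ((i + 1, j - 1), 0) + c ((i + 1, j - 1), 1) - c ((i, j), 2) = 0 := fun i j => by
    simpa [circulation, sub_eq_add_neg] using hcirc (i, j)
  -- Eliminating the components `0` and `2` from the two vertex conditions and the hexagon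
  -- condition leaves the Laplacian of the triangular lattice.
  have h1 : ∀ n, c (n, 1) = 0 := eq_zero_of_harmonic (hlim' 1) fun ⟨i, j⟩ => by
    have c0 := hC (i - 1) j
    have c1 := hC (i - 1) (j + 1)
    have d1 := hD (i - 1) j
    have d2 := hD (i - 1) (j + 1)
    have d3 := hD i (j - 1)
    have d4 := hD i j
    have f1 := hD' (i - 1) j
    have f2 := hD' i j
    have f3 := hD' i (j - 1)
    simp only [sub_add_cancel, add_sub_cancel_right, Prod.mk_add_mk, add_zero,
      ← sub_eq_add_neg] at *
    linear_combination (c1 - d2 + d4) - (c0 - d1 + d3) - ((f2 - d4) - 2 * (f1 - d1) + (f3 - d3))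
  have h2 : ∀ n, c (n, 2) = 0 := eq_zero_of_shift_invariant (hlim' 2) (v := (0, 1)) (by simp)
    fun ⟨i, j⟩ => by
      have e1 := hD i j
      have e2 := hD' i j
      rw [h1] at e1 e2
      simp only [Prod.mk_add_mk, add_zero]
      linear_combination e2 - e1
  funext ⟨⟨i, j⟩, k⟩
  have e1 := hD i j
  fin_cases k
  · simpa [h1, h2] using e1
  · exact h1 _
  · exact h2 _

/-- The alternating flow of strength one around the hexagon `n`. -/
def loopFlow (n : ℤ × ℤ) : Edge → ℂ :=
  Pi.single (n, 0) 1 - Pi.single (n + (1, 0), 1) 1 + Pi.single (n + (1, 0), 2) 1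
    - Pi.single (n + (1, -1), 0) 1 + Pi.single (n + (1, -1), 1) 1 - Pi.single (n, 2) 1

theorem isFlow_loopFlow (n : ℤ × ℤ) : IsFlow (loopFlow n) := by
  constructor <;> intro k
  · simp only [Fin.sum_univ_three, loopFlow, Pi.add_apply, Pi.sub_apply, Pi.single_apply,
      Prod.mk.injEq]
    simp
    ring
  · have h1 : k + (1, 0) = n + (1, -1) ↔ k + (0, 1) = n := by
      simp only [Prod.ext_iff, Prod.fst_add, Prod.snd_add]
      omega
    have h2 : k + (0, 1) = n + (1, 0) ↔ k = n + (1, -1) := by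
      simp only [Prod.ext_iff, Prod.fst_add, Prod.snd_add]
      omega
    simp only [Fin.sum_univ_three, loopFlow, Pi.add_apply, Pi.sub_apply, Pi.single_apply,
      Prod.mk.injEq]
    simp only [shift, Matrix.cons_val_zero, Matrix.cons_val_one, Matrix.cons_val]
    simp [h1, h2, show k + ((0, 0) : ℤ × ℤ) = k from add_zero k]
    ring

theorem loopFlow_eq_zero {n : ℤ × ℤ} {e : Edge} (he : e ∉ hexagon n) : loopFlow n e = 0 := by
  simp only [hexagon, Finset.mem_insert, Finset.mem_singleton, not_or] at he
  simp [loopFlow, he]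

/-- In the row of hexagons `(k, 0)`, the edge `((k, 0), 0)` belongs to one hexagon only. -/
theorem loopFlow_row (k l : ℤ) : loopFlow (k, 0) ((l, 0), 0) = if l = k then 1 else 0 := by
  simp [loopFlow, Pi.single_apply]

/-! ### The eigenspace of the Hamiltonian -/

theorem tendsto_edges (F : EdgesL2) : Tendsto (fun e => F e) cofinite (𝓝 0) := by
  have h := ((lp.memℓp F).summable (by norm_num)).tendsto_cofinite_zero
  rw [tendsto_zero_iff_norm_tendsto_zero]
  have h2 := (Real.continuous_sqrt.tendsto 0).comp h
  rw [Real.sqrt_zero] at h2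
  refine h2.congr fun e => ?_
  simp [Real.sqrt_sq]

/-- The coefficient of the orthogonal projection of the function on the edge `e` to the line spanned
by a nonzero `f`. -/
def coef (m : ℝ≥0) (f : EdgeL2) (e : Edge) : GraphL2 m →L[ℂ] ℂ :=
  (inner ℂ f f)⁻¹ • (innerSL ℂ f ∘L lp.evalCLM ℂ (fun _ : Edge => EdgeL2) 2 e ∘L
    WithLp.fstL 2 ℂ EdgesL2 (VertexL2 m))

variable {m : ℝ≥0} {f : EdgeL2}

theorem coef_apply (e : Edge) (U : GraphL2 m) :
    coef m f e U = (inner ℂ f f)⁻¹ * inner ℂ f (U.fst e) := rfl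

theorem coef_of_eq (hf : f ≠ 0) {e : Edge} {U : GraphL2 m} {c : ℂ} (h : U.fst e = c • f) :
    coef m f e U = c := by
  have : inner ℂ f f ≠ 0 := inner_self_ne_zero.2 hf
  rw [coef_apply, h, inner_smul_right]
  field_simp

theorem tendsto_coef (U : GraphL2 m) : Tendsto (fun e => coef m f e U) cofinite (𝓝 0) := by
  have h : Continuous fun g : EdgeL2 => (inner ℂ f f)⁻¹ * inner ℂ f g := by fun_prop
  have := (h.tendsto 0).comp (tendsto_edges U.fst)
  rw [inner_zero_right, mul_zero] at this
  exact this

/-- The states which are multiples of `f` on every edge, with coefficients that obey Kirchhoff's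
rule, and whose vertices are at rest. -/
structure IsFlowState (f : EdgeL2) (U : GraphL2 m) : Prop where
  edge : ∀ e, U.fst e = coef m f e U • f
  flow : IsFlow fun e => coef m f e U
  vertex : U.snd = 0

theorem isClosed_setOf_isFlowState (f : EdgeL2) : IsClosed {U : GraphL2 m | IsFlowState f U} := by
  have h : {U : GraphL2 m | IsFlowState f U} = (⋂ e, {U | U.fst e = coef m f e U • f}) ∩
      ((⋂ n : ℤ × ℤ, {U | ∑ i : Fin 3, coef m f (n, i) U = 0}) ∩
        (⋂ n : ℤ × ℤ, {U | ∑ i : Fin 3, coef m f (n + shift i, i) U = 0})) ∩ {U | U.snd = 0} := by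
    ext U
    simp only [mem_inter_iff, mem_iInter, mem_ofPred_eq]
    exact ⟨fun h => ⟨⟨h.edge, h.flow⟩, h.vertex⟩, fun h => ⟨h.1.1, h.1.2, h.2⟩⟩
  rw [h]
  refine ((isClosed_iInter fun e => isClosed_eq ?_ (by fun_prop)).inter
    ((isClosed_iInter fun n => isClosed_eq (by fun_prop) continuous_const).inter
      (isClosed_iInter fun n => isClosed_eq (by fun_prop) continuous_const))).inter
    (isClosed_eq (WithLp.sndL 2 ℂ EdgesL2 (VertexL2 m)).continuous continuous_const)
  exact (lp.evalCLM ℂ (fun _ : Edge => EdgeL2) 2 e ∘L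
    WithLp.fstL 2 ℂ EdgesL2 (VertexL2 m)).continuous

theorem mem_eigenspace_iff_mem_graph {a : ℝ} {κinv : ℝ≥0} {q : ℝ → ℝ} {z : ℂ} (U : GraphL2 m) :
    U ∈ eigenspace (hamiltonian a κinv m q) z ↔ (U, z • U) ∈ hamiltonianGraph a κinv m q := by
  rw [← graph_hamiltonian, LinearPMap.mem_graph_iff]
  constructor
  · rintro ⟨hU, h⟩
    exact ⟨⟨U, hU⟩, rfl, h⟩
  · rintro ⟨⟨V, hV⟩, h1, h2⟩
    obtain rfl : V = U := h1
    exact ⟨hV, h2⟩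

/-- For positive mass, functions of the vertices that agree almost everywhere are equal. -/
theorem eq_of_ae_eq_smul_count {m : ℝ≥0} (hm : m ≠ 0) {g h : Vertex → ℂ}
    (hgh : g =ᵐ[(m : ℝ≥0∞) • (Measure.count : Measure Vertex)] h) : g = h := by
  have : ae ((m : ℝ≥0∞) • (Measure.count : Measure Vertex)) = ⊤ := by
    rw [ae_eq_top]
    intro v
    simp [hm]
  rw [EventuallyEq, this] at hgh
  exact funext (eventually_top.1 hgh)

section Robin

variable {a : ℝ} {κinv : ℝ≥0} {q : ℝ → ℝ} {z : ℂ} {u₀ du₀ : ℝ → ℂ} {w₀ : EdgeL2}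

/-- The displacements of an eigenfunction vanish: along a row of the lattice they are constant,
and they tend to zero at infinity. -/
theorem displacement_eq_zero (hq : MemLp q 2 unitMeasure)
    (h₀ : IsRobinSolution (edgeCoeff a q z) ((a : ℂ) * (κinv : ℂ)) f u₀ du₀ w₀)
    {U : GraphL2 m} {u du : Edge → ℝ → ℂ} {w : EdgesL2} {ω φ : Vertex → ℂ}
    (h : IsHamiltonianPair a κinv m q U (z • U) u du w ω φ)
    (hw : ∀ e, w e =ᵐ[unitMeasure] fun x => edgeCoeff a q z x * u e x) (v : Vertex) :
    ω v = 0 := by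
  have hP := memLp_edgeCoeff a hq z
  have hne := h₀.du_one_ne_zero hP
  have hrel : ∀ e, ω (origin e) = ω (terminus e) * du₀ 1 := fun e => by
    rw [← h.robin_origin e, ← h.robin_terminus e]
    exact h₀.displacement_mul_eq (h.isH2 e) (hw e)
  obtain ⟨K, hK⟩ := exists_norm_initial_le hP
  have hlim : Tendsto (fun n : ℤ × ℤ => ω (Sum.inl n)) cofinite (𝓝 0) := by
    have hn : Tendsto (fun n : ℤ × ℤ => ‖U.fst (n, 0)‖) cofinite (𝓝 0) := by
      have := ((tendsto_edges U.fst).comp (Function.Injective.tendsto_cofinite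
        (f := fun n : ℤ × ℤ => ((n, 0) : Edge)) fun _ _ h => (Prod.ext_iff.1 h).1)).norm
      rw [norm_zero] at this
      exact this
    refine squeeze_zero_norm
      (a := fun n => K * ‖U.fst (n, 0)‖ + ‖(a : ℂ) * (κinv : ℂ)‖ * (K * ‖U.fst (n, 0)‖))
      (fun n => ?_) ?_
    · obtain ⟨h1, h2⟩ := hK _ _ _ _ (h.isH2 (n, 0)) (hw (n, 0))
      have h3 : ω (Sum.inl n) = u (n, 0) 0 - (a : ℂ) * (κinv : ℂ) * du (n, 0) 0 :=
        (h.robin_origin (n, 0)).symm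
      rw [h3]
      refine (norm_sub_le _ _).trans ?_
      rw [norm_mul _ (du (n, 0) 0)]
      gcongr
    · simpa using (hn.const_mul K).add ((hn.const_mul K).const_mul ‖(a : ℂ) * (κinv : ℂ)‖)
  have hinl : ∀ n : ℤ × ℤ, ω (Sum.inl n) = 0 :=
    eq_zero_of_shift_invariant hlim (v := (1, 0)) (by simp) fun n => by
      have h1 := hrel (n, 0)
      have h2 := hrel (n + (1, 0), 1)
      simp only [origin, terminus, shift, Matrix.cons_val_zero, Matrix.cons_val_one,
        add_sub_cancel_right, show n - ((0, 0) : ℤ × ℤ) = n from sub_zero n] at h1 h2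
      rw [h1, h2]
  rcases v with n | n
  · exact hinl n
  · have h1 := hrel (n, 0)
    simp only [origin, terminus, shift, Matrix.cons_val_zero,
      show n - ((0, 0) : ℤ × ℤ) = n from sub_zero n] at h1
    rw [hinl] at h1
    exact (mul_eq_zero.1 h1.symm).resolve_right hne

theorem isFlowState_of_isHamiltonianPair (ha : 0 < a) (hq : MemLp q 2 unitMeasure)
    (h₀ : IsRobinSolution (edgeCoeff a q z) ((a : ℂ) * (κinv : ℂ)) f u₀ du₀ w₀)
    {U : GraphL2 m} {u du : Edge → ℝ → ℂ} {w : EdgesL2} {ω φ : Vertex → ℂ}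
    (h : IsHamiltonianPair a κinv m q U (z • U) u du w ω φ) : IsFlowState f U := by
  have hP := memLp_edgeCoeff a hq z
  have ha' : (a : ℂ) ≠ 0 := by exact_mod_cast ha.ne'
  have hw : ∀ e, w e =ᵐ[unitMeasure] fun x => edgeCoeff a q z x * u e x := fun e => by
    filter_upwards [h.edge_eq e, (h.isH2 e).ae_eq, Lp.coeFn_smul z (U.fst e)] with x e1 e2 e3
    change (z • U.fst e : EdgeL2) x = _ at e1
    rw [e3, Pi.smul_apply, smul_eq_mul, e2] at e1
    have := (edgeCoeff_eq_iff ha q z (w e x) (u e x) 0 x).2 (by rw [zero_add, e1])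
    rwa [mul_zero, sub_zero] at this
  have hω := displacement_eq_zero hq h₀ h hw
  have hU : U.snd = 0 := by
    rw [Lp.eq_zero_iff_ae_eq_zero]
    exact h.displacement.trans (Eventually.of_forall hω)
  have hforce : ∀ v, netForce a du v = 0 := fun v => by
    rw [h.force v]
    by_cases hm : m = 0
    · simp [hm]
    · have hz : z • U.snd = 0 := by rw [hU, smul_zero]
      have hφ := h.acceleration
      rw [WithLp.smul_snd, hz] at hφ
      rw [← eq_of_ae_eq_smul_count hm ((Lp.coeFn_zero ℂ 2 _).symm.trans hφ)]
      simp
  have hmul : ∀ e, U.fst e = du e 0 • f ∧ du e 1 = du e 0 * du₀ 1 := fun e =>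
    h₀.eq_smul hP (h.isH2 e) (hw e) (by rw [h.robin_origin e, hω])
  have hcoef : ∀ e, coef m f e U = du e 0 := fun e => coef_of_eq h₀.ne_zero (hmul e).1
  refine ⟨fun e => by rw [hcoef]; exact (hmul e).1, ⟨fun n => ?_, fun n => ?_⟩, hU⟩
  · have := hforce (Sum.inl n)
    simp only [netForce, Finset.sum_neg_distrib, ← Finset.mul_sum] at this
    simpa [hcoef, ha'] using this
  · have := hforce (Sum.inr n)
    simp only [netForce, (hmul _).2, ← mul_assoc, mul_comm _ (du₀ 1), ← Finset.mul_sum] at this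
    simpa [hcoef, ha', h₀.du_one_ne_zero hP] using this

theorem IsFlowState.exists_isHamiltonianPair (ha : 0 < a)
    (h₀ : IsRobinSolution (edgeCoeff a q z) ((a : ℂ) * (κinv : ℂ)) f u₀ du₀ w₀)
    {U : GraphL2 m} (hU : IsFlowState f U) :
    ∃ u du w, IsHamiltonianPair a κinv m q U (z • U) u du w 0 0 := by
  have hf : ‖f‖ ≠ 0 := norm_ne_zero_iff.2 h₀.ne_zero
  have hmem : Memℓp (fun e : Edge => coef m f e U • w₀) 2 := by
    refine (lp.memℓp (((‖w₀‖ / ‖f‖ : ℝ) : ℂ) • U.fst)).mono' fun e => le_of_eq ?_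
    rw [lp.coeFn_smul, Pi.smul_apply, norm_smul, norm_smul]
    have h1 : ‖U.fst e‖ = ‖coef m f e U‖ * ‖f‖ := by
      conv_lhs => rw [hU.edge e]
      exact norm_smul _ _
    change _ = _ * ‖U.fst e‖
    rw [h1, Complex.norm_real, Real.norm_of_nonneg (by positivity)]
    field_simp
  have hsnd : U.snd = 0 := hU.vertex
  refine ⟨fun e => coef m f e U • u₀, fun e => coef m f e U • du₀, ⟨_, hmem⟩,
    fun e => ?_, fun e => ?_, ?_, ?_, fun e => ?_, fun e => ?_, fun v => ?_⟩
  · rw [hU.edge e]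
    exact h₀.isH2.smul _
  · change (z • U.fst e : EdgeL2) =ᵐ[unitMeasure] fun x =>
      -(a : ℂ) * (coef m f e U • w₀ : EdgeL2) x + (q x : ℂ) * (coef m f e U * u₀ x)
    nth_rw 1 [hU.edge e]
    filter_upwards [Lp.coeFn_smul z (coef m f e U • f), Lp.coeFn_smul (coef m f e U) f,
      Lp.coeFn_smul (coef m f e U) w₀, h₀.isH2.ae_eq, h₀.eq] with x e1 e2 e3 e4 e5
    have := (edgeCoeff_eq_iff ha q z (w₀ x) (u₀ x) 0 x).1 (by rw [e5, mul_zero, sub_zero])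
    rw [e1, Pi.smul_apply, e2, Pi.smul_apply, e3, Pi.smul_apply, e4]
    simp only [smul_eq_mul]
    linear_combination coef m f e U * this
  · rw [hsnd]
    exact Lp.coeFn_zero _ _ _
  · rw [WithLp.smul_snd, hsnd, smul_zero]
    exact Lp.coeFn_zero _ _ _
  · simp only [Pi.smul_apply, smul_eq_mul, Pi.zero_apply, h₀.u_zero, h₀.du_zero]
    ring
  · simp only [Pi.smul_apply, smul_eq_mul, Pi.zero_apply]
    linear_combination coef m f e U * h₀.robin_one
  · have h1 := hU.flow
    rcases v with n | n
    · simp only [netForce, Pi.smul_apply, smul_eq_mul, Finset.sum_neg_distrib, ← Finset.mul_sum,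
        ← Finset.sum_mul, h1.1 n]
      simp
    · simp only [netForce, Pi.smul_apply, smul_eq_mul, ← Finset.mul_sum,
        ← Finset.sum_mul, h1.2 n]
      simp

theorem mem_eigenspace_iff (ha : 0 < a) (hq : MemLp q 2 unitMeasure)
    (h₀ : IsRobinSolution (edgeCoeff a q z) ((a : ℂ) * (κinv : ℂ)) f u₀ du₀ w₀) (U : GraphL2 m) :
    U ∈ eigenspace (hamiltonian a κinv m q) z ↔ IsFlowState f U := by
  rw [mem_eigenspace_iff_mem_graph]
  constructor
  · rintro ⟨u, du, w, ω, φ, h⟩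
    exact isFlowState_of_isHamiltonianPair ha hq h₀ h
  · intro hU
    obtain ⟨u, du, w, h⟩ := hU.exists_isHamiltonianPair ha h₀
    exact ⟨u, du, w, 0, 0, h⟩

end Robin

/-! ### Simple loop states -/

/-- The function on the edges which equals `loopFlow n e • f` on every edge `e`. -/
def loopEdges (f : EdgeL2) (n : ℤ × ℤ) : EdgesL2 :=
  lp.single 2 (n, 0) f - lp.single 2 (n + (1, 0), 1) f + lp.single 2 (n + (1, 0), 2) f
    - lp.single 2 (n + (1, -1), 0) f + lp.single 2 (n + (1, -1), 1) f - lp.single 2 (n, 2) f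

/-- The state with edge functions `loopEdges f n` and all vertices at rest. -/
def loopState (m : ℝ≥0) (f : EdgeL2) (n : ℤ × ℤ) : GraphL2 m :=
  WithLp.toLp 2 (loopEdges f n, 0)

theorem loopState_fst (n : ℤ × ℤ) (e : Edge) : (loopState m f n).fst e = loopFlow n e • f := by
  have h : ∀ e' : Edge,
      (Pi.single e' f : Edge → EdgeL2) e = (Pi.single e' 1 : Edge → ℂ) e • f := by
    intro e'
    by_cases he : e = e'
    · subst he
      simp
    · simp [he]
  change loopEdges f n e = _
  simp only [loopEdges, loopFlow, lp.coeFn_add, lp.coeFn_sub, lp.coeFn_single, Pi.add_apply,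
    Pi.sub_apply, h, add_smul, sub_smul]

theorem inner_loopState (hf : f ≠ 0) (n : ℤ × ℤ) {U : GraphL2 m} (hU : U.snd = 0) :
    inner ℂ (loopState m f n) U = inner ℂ f f * circulation (fun e => coef m f e U) n := by
  have hff : inner ℂ f f ≠ 0 := inner_self_ne_zero.2 hf
  have h : inner ℂ (loopState m f n) U = inner ℂ (loopEdges f n) U.fst := by
    rw [WithLp.prod_inner_apply, show U.ofLp.2 = 0 from hU, inner_zero_right, add_zero]
    rfl
  rw [h, circulation]
  simp only [coef_apply, loopEdges, inner_add_left, inner_sub_left, lp.inner_single_left]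
  field_simp

theorem isFlowState_loopState (hf : f ≠ 0) (n : ℤ × ℤ) : IsFlowState f (loopState m f n) := by
  have h : ∀ e, coef m f e (loopState m f n) = loopFlow n e := fun e =>
    coef_of_eq hf (loopState_fst n e)
  refine ⟨fun e => ?_, ?_, rfl⟩
  · rw [h, loopState_fst]
  · simp only [h]
    exact isFlow_loopFlow n

/-- A flow state orthogonal to all loop states has no circulation and thus vanishes. -/
theorem IsFlowState.eq_zero_of_inner_loopState (hf : f ≠ 0) {U : GraphL2 m} (hU : IsFlowState f U)
    (h : ∀ n, inner ℂ (loopState m f n) U = 0) : U = 0 := by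
  have hc := hU.flow.eq_zero (fun n => by
    have := h n
    rw [inner_loopState hf n hU.vertex] at this
    exact (mul_eq_zero.1 this).resolve_left (inner_self_ne_zero.2 hf)) (tendsto_coef U)
  have h1 : U.fst = 0 := by
    ext1
    funext e
    rw [hU.edge e, congrFun hc e, Pi.zero_apply, zero_smul]
    rfl
  exact (WithLp.ofLp_injective 2) (Prod.ext h1 hU.vertex)

theorem isSimpleLoopState_loopState {a : ℝ} (ha : 0 < a) {κinv : ℝ≥0} {q : ℝ → ℝ} {z : ℂ}
    {u₀ du₀ : ℝ → ℂ} {w₀ : EdgeL2}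
    (h₀ : IsRobinSolution (edgeCoeff a q z) ((a : ℂ) * (κinv : ℂ)) f u₀ du₀ w₀) (n : ℤ × ℤ) :
    IsSimpleLoopState a κinv m q z (loopState m f n) := by
  obtain ⟨u, du, w, h⟩ :=
    (isFlowState_loopState (m := m) h₀.ne_zero n).exists_isHamiltonianPair (κinv := κinv) ha h₀
  refine ⟨fun h0 => ?_, (mem_eigenspace_iff_mem_graph _).2 ⟨u, du, w, 0, 0, h⟩,
    ⟨n, fun e he => ?_⟩, u, du, w, 0, h⟩
  · have h1 := loopState_fst (m := m) (f := f) n (n, 0)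
    rw [h0] at h1
    have h2 : (0 : EdgeL2) = loopFlow n (n, 0) • f := h1
    simp [loopFlow] at h2
    exact h₀.ne_zero h2.symm
  · rw [loopState_fst, loopFlow_eq_zero he, zero_smul]

end

end HexGraph

theorem mainTheorem4 (a : ℝ) (ha : 0 < a) (κinv m : ℝ≥0) (q : ℝ → ℝ)
    (hq : MemLp q 2 (volume.restrict (Ioc (0 : ℝ) 1)))
    (hsymm : ∀ᵐ x ∂(volume.restrict (Ioc (0 : ℝ) 1)), q (1 - x) = q x)
    (z : ℂ) (hz : z ∈ HexGraph.Sigma0 a κinv q) :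
    (∃ U ∈ HexGraph.eigenspace (HexGraph.hamiltonian a κinv m q) z, U ≠ 0) ∧
    ¬ FiniteDimensional ℂ (HexGraph.eigenspace (HexGraph.hamiltonian a κinv m q) z) ∧
    (Submodule.span ℂ
        {U | HexGraph.IsSimpleLoopState a κinv m q z U}).topologicalClosure =
      HexGraph.eigenspace (HexGraph.hamiltonian a κinv m q) z := by
  obtain ⟨f, u₀, du₀, w₀, h₀⟩ := HexGraph.exists_isRobinSolution ha hq hz
  have hf := h₀.ne_zero
  have hloop := HexGraph.isSimpleLoopState_loopState (m := m) ha h₀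
  have hmem := HexGraph.mem_eigenspace_iff (m := m) ha hq h₀
  set E := HexGraph.eigenspace (HexGraph.hamiltonian a κinv m q) z with hE
  refine ⟨⟨_, (hloop 0).2.1, (hloop 0).1⟩, fun hfin => ?_, ?_⟩
  -- The loop states of a row of hexagons are separated by the coefficients at edges that belong to
  -- only one hexagon of the row.
  · have hli : LinearIndependent ℂ
        fun k : ℤ => (⟨HexGraph.loopState m f (k, 0), (hloop (k, 0)).2.1⟩ : E) := by
      have hval : ∀ k l : ℤ, HexGraph.coef m f ((l, 0), 0) (HexGraph.loopState m f (k, 0))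
          = if l = k then 1 else 0 := fun k l => by
        rw [HexGraph.coef_of_eq hf (HexGraph.loopState_fst _ _), HexGraph.loopFlow_row]
      refine LinearIndependent.of_pairwise_dual_eq_zero_one _
        (fun k : ℤ => (HexGraph.coef m f ((k, 0), 0) : _ →ₗ[ℂ] ℂ) ∘ₗ E.subtype) ?_ ?_
      · intro k l hkl
        exact (hval l k).trans (if_neg hkl)
      · intro k
        exact (hval k k).trans (if_pos rfl)
    exact not_finite_iff_infinite.2 (inferInstance : Infinite ℤ) hli.finite
  · set L := (Submodule.span ℂ
      {U | HexGraph.IsSimpleLoopState a κinv m q z U}).topologicalClosure with hL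
    have hclosed : IsClosed (E : Set (HexGraph.GraphL2 m)) := by
      convert HexGraph.isClosed_setOf_isFlowState (m := m) f using 1
      ext U
      exact hmem U
    have hLE : L ≤ E := Submodule.topologicalClosure_minimal _
      (Submodule.span_le.2 fun U hU => hU.2.1) hclosed
    have hLc : IsClosed (L : Set (HexGraph.GraphL2 m)) := Submodule.isClosed_topologicalClosure _
    have : CompleteSpace L := hLc.completeSpace_coe
    have hbot : Lᗮ ⊓ E = ⊥ := by
      refine (Submodule.eq_bot_iff _).2 fun U hU => ?_
      refine ((hmem U).1 hU.2).eq_zero_of_inner_loopState hf fun n => ?_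
      exact hU.1 _ (Submodule.le_topologicalClosure _ (Submodule.subset_span (hloop n)))
    rw [← Submodule.sup_orthogonal_inf_of_hasOrthogonalProjection hLE, hbot, sup_bot_eq]
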